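/- Let $q$ be a prime power, $m\ge 1$, let $s\ge 1$ divide $m$, and let $\beta\in\mathbb F_{q^s}\subseteq\mathbb F_{q^m}$ be such that $\beta^{q^0},\beta^{q^1},\dots,\beta^{q^{s-1}}$ is a (normal) basis of $\mathbb F_{q^s}$ over $\mathbb F_q$. The $q$-transform with respect to this basis maps a linearized polynomial $a=\sum_{i=0}^{s-1}a_i x^{q^i}$ with coefficients in $\mathbb F_{q^m}$ to the linearized polynomial $\hat a=\sum_{j=0}^{s-1}\hat a_j x^{q^j}$ with $$\hat a_j=a(\beta^{q^j})=\sum_{i=0}^{s-1}a_i\,\beta^{q^{i+j}},\qquad j=0,\dots,s-1 .$$ An algorithm for the parameter $s$ is an algebraic computation tree which receives $2s$ field elements, uses the constants $0,1$, the field operations $+,-,\cdot,/$ (never dividing by zero) and branching on whether a computed value is zero, and returns $s$ field elements. The tree may depend on $s$, but not on $q$, $m$ or $\beta$. Its cost is the maximal number of steps (constants, field operations, zero tests) on a path. It computes the $q$-transform if, for all $q,m,\beta$ as above and all $a$, on input $(\beta^{q^0},\dots,\beta^{q^{s-1}},a_0,\dots,a_{s-1})$ over $\mathbb F_{q^m}$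 it returns $(\hat a_0,\dots,\hat a_{s-1})$; it computes the inverse $q$-transform if, for all such data, on input $(\beta^{q^0},\dots,\beta^{q^{s-1}},\hat a_0,\dots,\hat a_{s-1})$ it returns $(a_0,\dots,a_{s-1})$. **Theorem.** Let $\mathcal D(s)$ be the maximum of the least cost of an algorithm computing the $q$-transform and the least cost of an algorithm computing the inverse $q$-transform for the parameter $s$. Then $\mathcal D(s)<\infty$ for all $s$, and $$\mathcal D(s)\in O\bigl(s\,\log^2(s)\,\log\log(s)\bigr)\qquad(s\to\infty).$$ In particular, the implied constant does not depend on $q$, $m$ or the normal basis. -/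

import Mathlib

open Filter Asymptotics

universe u v

/-- The four arithmetic operations of a field. -/
inductive ArithOp where
  | add
  | sub
  | mul
  | div

open Classical in
/-- The result of an arithmetic operation; division by zero is undefined. -/
noncomputable def ArithOp.apply {F : Type u} [Field F] : ArithOp → F → F → Option F
  | .add, x, y => some (x + y)
  | .sub, x, y => some (x - y)
  | .mul, x, y => some (x * y)
  | .div, x, y => if y = 0 then none else some (x / y)

/-- Algebraic computation trees with `k` outputs, at a point where `n` values (the inputs and the
results of the earlier steps) are available. A step appends one of the constants `0`, `1` or the
result of an arithmetic operation on two available values, or tests an available value for zero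
and branches. The tree does not mention a field, so it is an algorithm over all fields at once. -/
inductive CompTree (k : ℕ) : ℕ → Type where
  /-- stop and return the selected available values -/
  | output {n : ℕ} (r : Fin k → Fin n) : CompTree k n
  /-- append the constant `0` (`one = false`) or `1` (`one = true`) -/
  | const {n : ℕ} (one : Bool) (next : CompTree k (n + 1)) : CompTree k n
  /-- append the result of an arithmetic operation -/
  | arith {n : ℕ} (o : ArithOp) (i j : Fin n) (next : CompTree k (n + 1)) : CompTree k n
  /-- branch on whether the value `i` is zero -/
  | test {n : ℕ} (i : Fin n) (ifZero ifNonzero : CompTree k n) : CompTree k n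

open Classical in
/-- Execution of a computation tree over the field `F` on the values `x`. The result is `none` if
and only if a division by zero is attempted. -/
noncomputable def CompTree.run {F : Type u} [Field F] {k : ℕ} :
    {n : ℕ} → CompTree k n → (Fin n → F) → Option (Fin k → F)
  | _, .output r, x => some fun l => x (r l)
  | _, .const one next, x => next.run (Fin.snoc x (if one then (1 : F) else 0))
  | _, .arith o i j next, x => (o.apply (x i) (x j)).bind fun y => next.run (Fin.snoc x y)
  | _, .test i ifZero ifNonzero, x => if x i = 0 then ifZero.run x else ifNonzero.run x

/-- Worst-case number of steps (constants, arithmetic operations, zero tests) along a branch. -/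
def CompTree.cost {k : ℕ} : {n : ℕ} → CompTree k n → ℕ
  | _, .output _ => 0
  | _, .const _ next => next.cost + 1
  | _, .arith _ _ _ next => next.cost + 1
  | _, .test _ ifZero ifNonzero => max ifZero.cost ifNonzero.cost + 1

/-- The linearized polynomial `∑ aᵢ x^(q^i)` of `q`-degree `< s` with coefficient vector `a`. -/
noncomputable def linPoly {F : Type u} [Field F] (q : ℕ) {s : ℕ} (a : Fin s → F) :
    Polynomial F :=
  ∑ i : Fin s, Polynomial.C (a i) * Polynomial.X ^ (q ^ (i : ℕ))

/-- The vector `(β, β^q, …, β^(q^(s-1)))`. -/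
def conjugates {F : Type u} [Field F] (q s : ℕ) (β : F) : Fin s → F :=
  fun j => β ^ (q ^ (j : ℕ))

/-- The `q`-transform on coefficient vectors: `âⱼ = a(β^(q^j))`. -/
noncomputable def qTransform {F : Type u} [Field F] (q : ℕ) {s : ℕ} (β : F) (a : Fin s → F) :
    Fin s → F :=
  fun j => (linPoly q a).eval (conjugates q s β j)

/-- `β` generates a normal basis `β, β^q, …, β^(q^(s-1))` of `E` over the field `K` with `q`
elements; in particular `E` has degree `s` over `K`. -/
def IsNormalElement (K : Type u) (E : Type v) [Field K] [Field E] [Algebra K E] (s : ℕ) (β : E) :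
    Prop :=
  ∃ b : Module.Basis (Fin s) K E, ∀ i, b i = conjugates (Nat.card K) s β i

/-- `T` computes the `q`-transform: for every finite field extension `F / K`, every intermediate
field `E` and every normal basis of `E / K` with `s` elements (with `q = #K` and `m = [F : K]`,
the existence of `E` means `s ∣ m`), on input of the normal basis and of the coefficients of `a`
it returns the coefficients of the `q`-transform of `a`. -/
def CompTree.ComputesQT {s : ℕ} (T : CompTree s (s + s)) : Prop :=
  ∀ (K : Type u) (F : Type v) [Field K] [Finite K] [Field F] [Finite F] [Algebra K F]
    (E : IntermediateField K F) (β : E), IsNormalElement K E s β →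
    ∀ a : Fin s → F,
      T.run (Fin.append (conjugates (Nat.card K) s (β : F)) a) =
        some (qTransform (Nat.card K) (β : F) a)

/-- `T` computes the inverse `q`-transform: on input of the normal basis and of the coefficients
of the `q`-transform of `a` it returns the coefficients of `a`. -/
def CompTree.ComputesInvQT {s : ℕ} (T : CompTree s (s + s)) : Prop :=
  ∀ (K : Type u) (F : Type v) [Field K] [Finite K] [Field F] [Finite F] [Algebra K F]
    (E : IntermediateField K F) (β : E), IsNormalElement K E s β →
    ∀ a : Fin s → F,
      T.run (Fin.append (conjugates (Nat.card K) s (β : F))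
        (qTransform (Nat.card K) (β : F) a)) = some a

/-- Infimum of the worst-case costs of the algorithms for the `q`-transform (`⊤` if none). -/
noncomputable def forwardQTComplexity (s : ℕ) : ℕ∞ :=
  ⨅ (T : CompTree s (s + s)) (_ : CompTree.ComputesQT.{u, v} T), (T.cost : ℕ∞)

/-- Infimum of the worst-case costs of the algorithms for the inverse `q`-transform. -/
noncomputable def inverseQTComplexity (s : ℕ) : ℕ∞ :=
  ⨅ (T : CompTree s (s + s)) (_ : CompTree.ComputesInvQT.{u, v} T), (T.cost : ℕ∞)

/-- Complexity of the `q`-transform and its inverse. -/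
noncomputable def qtComplexity (s : ℕ) : ℕ∞ :=
  max (forwardQTComplexity.{u, v} s) (inverseQTComplexity.{u, v} s)

/-! As `β` lies in the field with `q^s` elements, the sequence `β_k = β^(q^k)` has period `s`, and
`â_j = ∑ a_i β_(i+j)` is a cyclic correlation. With `B = ∑ β_k X^k` this says that, modulo `X^s -
1`, the polynomial `∑ â_j X^j` is `B` times the reversal `∑ a_i X^(s-i)` (`dvd_correlation`). The
transform thus costs one polynomial multiplication and `O(s)` further steps (`achieves_corr`).

The inverse transform is division by `B` modulo `X^s - 1`. Here `B` is a unit: a common factor with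
`X^s - 1` would give a nonzero `a` with `â = 0`, that is, a nonzero linearized polynomial of degree
at most `q^(s-1)` with `q^s` zeros (`isUnit_of_dvd_of_dvd`, `IsNormalElement.injective`). The
division uses the division steps of Bernstein and Yang on `(X^s - 1, B)`. Each step inspects
constant coefficients only, so `N` steps depend on the input modulo `X^N` and can be composed by
divide and conquer (`Achieves.jump`), which costs a logarithmic factor over multiplication. After `N
≥ 2s` steps a nonzero constant `c` and `0` remain, and the transition matrix yields `Q` with `Q B ≡
c X^N` (`exists_const_of_isTransition`). Multiplication by `X^N` only rotates coefficients, so `Q â`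
shows the values `c a_i` in permuted order (`fold_inverse`).

Multiplication in `O(n log n log log n)` over every field is Schönhage's method: polynomials are cut
into chunks, the chunks are read in `V[X]/ψ` with `ψ = 1 + X^t + ⋯ + X^(t(p-1))`, where `X` serves
as the root of unity of a radix-`p` FFT, and the pointwise products are treated recursively
(`mulMod_step`, `mulMod_phi_pow`, `fastMul`). It needs `p` invertible: `p = 3` in characteristic
two, `p = 2` otherwise.

Uniformity in the field comes from treating all instances simultaneously. A computed value is a
function of the instance, an element of a product of fields; branch-free parts are straight-line
computations in this commutative ring, and a zero test splits the set of instances (`Achieves`).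
This is why multiplication is developed over commutative rings. -/

open Polynomial

/-! ### Straight-line computations in a commutative ring. -/

/-- Straight-line computations in a commutative ring: `SLP Ω l w A c B` says that all elements of
`B` can be computed from those of `A` at cost `c`, where additions, subtractions and
multiplications by an element of `Ω` have cost `l` and general multiplications have cost `w`. -/
inductive SLP {R : Type*} [CommRing R] (Ω : Set R) (l w : ℕ) : Set R → ℕ → Set R → Prop
  | done {A B : Set R} {c : ℕ} : B ⊆ A → SLP Ω l w A c B
  | add {A B : Set R} {c : ℕ} {x y : R} : x ∈ A → y ∈ A →
      SLP Ω l w (insert (x + y) A) c B → SLP Ω l w A (c + l) B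
  | sub {A B : Set R} {c : ℕ} {x y : R} : x ∈ A → y ∈ A →
      SLP Ω l w (insert (x - y) A) c B → SLP Ω l w A (c + l) B
  | smul {A B : Set R} {c : ℕ} {x y : R} : x ∈ Ω → y ∈ A →
      SLP Ω l w (insert (x * y) A) c B → SLP Ω l w A (c + l) B
  | mul {A B : Set R} {c : ℕ} {x y : R} : x ∈ A → y ∈ A →
      SLP Ω l w (insert (x * y) A) c B → SLP Ω l w A (c + w) B

/-- The set of coefficients of a polynomial. -/
def cf {R : Type*} [CommRing R] (P : R[X]) : Set R := Set.range P.coeff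

theorem degree_C_mul_lt {R : Type*} [CommRing R] {P : R[X]} {n : ℕ} (u : R)
    (h : P.degree < n) : (C u * P).degree < n := by
  rw [degree_lt_iff_coeff_zero] at *
  intro m hm
  rw [coeff_C_mul, h m hm, mul_zero]

namespace SLP

variable {R : Type*} [CommRing R] {Ω : Set R} {l w : ℕ}

theorem mono {A B : Set R} {c : ℕ} (h : SLP Ω l w A c B) :
    ∀ {A' B' : Set R} {c' : ℕ}, A ⊆ A' → B' ⊆ B → c ≤ c' → SLP Ω l w A' c' B' := by
  induction h with
  | done h => exact fun hA hB _ => .done (hB.trans (h.trans hA))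
  | add hx hy _ ih =>
    intro A' B' c' hA hB hc
    obtain ⟨d, rfl⟩ := Nat.exists_eq_add_of_le hc
    rw [add_right_comm]
    exact .add (hA hx) (hA hy) (ih (Set.insert_subset_insert hA) hB (Nat.le_add_right _ _))
  | sub hx hy _ ih =>
    intro A' B' c' hA hB hc
    obtain ⟨d, rfl⟩ := Nat.exists_eq_add_of_le hc
    rw [add_right_comm]
    exact .sub (hA hx) (hA hy) (ih (Set.insert_subset_insert hA) hB (Nat.le_add_right _ _))
  | smul hx hy _ ih =>
    intro A' B' c' hA hB hc
    obtain ⟨d, rfl⟩ := Nat.exists_eq_add_of_le hc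
    rw [add_right_comm]
    exact .smul hx (hA hy) (ih (Set.insert_subset_insert hA) hB (Nat.le_add_right _ _))
  | mul hx hy _ ih =>
    intro A' B' c' hA hB hc
    obtain ⟨d, rfl⟩ := Nat.exists_eq_add_of_le hc
    rw [add_right_comm]
    exact .mul (hA hx) (hA hy) (ih (Set.insert_subset_insert hA) hB (Nat.le_add_right _ _))

theorem trans {A B C : Set R} {c d : ℕ} (h : SLP Ω l w A c B) :
    SLP Ω l w (A ∪ B) d C → SLP Ω l w A (c + d) C := by
  induction h with
  | done h =>
    intro h2
    rw [Set.union_eq_self_of_subset_right h] at h2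
    exact h2.mono le_rfl le_rfl (Nat.le_add_left _ _)
  | add hx hy _ ih =>
    intro h2
    rw [add_right_comm]
    exact .add hx hy (ih (h2.mono (Set.union_subset_union_left _ (Set.subset_insert _ _)) le_rfl
      le_rfl))
  | sub hx hy _ ih =>
    intro h2
    rw [add_right_comm]
    exact .sub hx hy (ih (h2.mono (Set.union_subset_union_left _ (Set.subset_insert _ _)) le_rfl
      le_rfl))
  | smul hx hy _ ih =>
    intro h2
    rw [add_right_comm]
    exact .smul hx hy (ih (h2.mono (Set.union_subset_union_left _ (Set.subset_insert _ _)) le_rfl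
      le_rfl))
  | mul hx hy _ ih =>
    intro h2
    rw [add_right_comm]
    exact .mul hx hy (ih (h2.mono (Set.union_subset_union_left _ (Set.subset_insert _ _)) le_rfl
      le_rfl))

theorem frame {A B : Set R} {c : ℕ} (h : SLP Ω l w A c B) : SLP Ω l w A c (A ∪ B) := by
  induction h with
  | done h => exact .done (Set.union_subset le_rfl h)
  | add hx hy _ ih =>
    exact .add hx hy (ih.mono le_rfl (Set.union_subset_union_left _ (Set.subset_insert _ _)) le_rfl)
  | sub hx hy _ ih =>
    exact .sub hx hy (ih.mono le_rfl (Set.union_subset_union_left _ (Set.subset_insert _ _)) le_rfl)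
  | smul hx hy _ ih =>
    exact .smul hx hy
      (ih.mono le_rfl (Set.union_subset_union_left _ (Set.subset_insert _ _)) le_rfl)
  | mul hx hy _ ih =>
    exact .mul hx hy (ih.mono le_rfl (Set.union_subset_union_left _ (Set.subset_insert _ _)) le_rfl)

/-- Sequential composition that keeps the intermediate results. -/
theorem seq {A B C : Set R} {c d : ℕ} (h : SLP Ω l w A c B) (h2 : SLP Ω l w (A ∪ B) d C) :
    SLP Ω l w A (c + d) (B ∪ C) :=
  h.trans (h2.frame.mono le_rfl (Set.union_subset_union_left _ Set.subset_union_right) le_rfl)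

theorem union {A B C : Set R} {c d : ℕ} (h : SLP Ω l w A c B) (h2 : SLP Ω l w A d C) :
    SLP Ω l w A (c + d) (B ∪ C) :=
  h.seq (h2.mono Set.subset_union_left le_rfl le_rfl)

theorem biUnion {A : Set R} {c : ℕ} (f : ℕ → Set R) (n : ℕ) (h : ∀ i < n, SLP Ω l w A c (f i)) :
    SLP Ω l w A (n * c) (⋃ i < n, f i) := by
  induction n with
  | zero => exact .done (by simp)
  | succ n ih =>
    rw [Nat.succ_mul]
    refine ((ih fun i hi => h i (by omega)).union (h n (by omega))).mono le_rfl ?_ le_rfl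
    intro x hx
    simp only [Set.mem_iUnion, exists_prop, Set.mem_union] at hx ⊢
    obtain ⟨i, hi, hx⟩ := hx
    rcases Nat.lt_succ_iff_lt_or_eq.mp hi with hi | rfl
    · exact .inl ⟨i, hi, hx⟩
    · exact .inr hx

theorem singleton_add {A : Set R} {x y : R} (hx : x ∈ A) (hy : y ∈ A) :
    SLP Ω l w A l {x + y} := by
  simpa using SLP.add (Ω := Ω) (l := l) (w := w) (c := 0) hx hy (.done (B := {x + y}) (by simp))

theorem singleton_sub {A : Set R} {x y : R} (hx : x ∈ A) (hy : y ∈ A) :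
    SLP Ω l w A l {x - y} := by
  simpa using SLP.sub (Ω := Ω) (l := l) (w := w) (c := 0) hx hy (.done (B := {x - y}) (by simp))

theorem singleton_smul {A : Set R} {x y : R} (hx : x ∈ Ω) (hy : y ∈ A) :
    SLP Ω l w A l {x * y} := by
  simpa using SLP.smul (Ω := Ω) (l := l) (w := w) (c := 0) hx hy (.done (B := {x * y}) (by simp))

theorem singleton_mul {A : Set R} {x y : R} (hx : x ∈ A) (hy : y ∈ A) :
    SLP Ω l w A w {x * y} := by
  simpa using SLP.mul (Ω := Ω) (l := l) (w := w) (c := 0) hx hy (.done (B := {x * y}) (by simp))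

/-- A polynomial is computed by computing its coefficients. -/
theorem poly {A : Set R} {P : R[X]} {n c : ℕ} (h0 : (0 : R) ∈ A) (hP : P.degree < n)
    (h : ∀ i < n, SLP Ω l w A c {P.coeff i}) : SLP Ω l w A (n * c) (cf P) := by
  refine (biUnion (fun i => {P.coeff i}) n h).frame.mono le_rfl ?_ le_rfl
  rintro _ ⟨i, rfl⟩
  by_cases hi : i < n
  · exact .inr (Set.mem_biUnion (x := i) hi rfl)
  · rw [degree_lt_iff_coeff_zero] at hP
    rw [hP i (by omega)]
    exact .inl h0

theorem sum {A : Set R} {c : ℕ} {ι : Type*} (s : Finset ι) (f : ι → R) (h0 : (0 : R) ∈ A)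
    (h : ∀ i ∈ s, SLP Ω l w A c {f i}) : SLP Ω l w A (s.card * (c + l)) {∑ i ∈ s, f i} := by
  classical
  induction s using Finset.induction_on with
  | empty => exact .done (by simpa using h0)
  | insert a s ha ih =>
    rw [Finset.sum_insert ha, Finset.card_insert_of_notMem ha, Nat.succ_mul, ← add_assoc]
    exact ((ih fun i hi => h i (Finset.mem_insert_of_mem hi)).union
      (h a (Finset.mem_insert_self _ _))).trans (singleton_add (by simp) (by simp))

theorem poly_add {A : Set R} {P Q : R[X]} {n : ℕ} (h0 : (0 : R) ∈ A) (hP : P.degree < n)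
    (hQ : Q.degree < n) (hPA : cf P ⊆ A) (hQA : cf Q ⊆ A) :
    SLP Ω l w A (n * l) (cf (P + Q)) :=
  poly h0 ((degree_add_le _ _).trans_lt (max_lt hP hQ)) fun i _ => by
    rw [coeff_add]
    exact singleton_add (hPA ⟨i, rfl⟩) (hQA ⟨i, rfl⟩)

theorem poly_sub {A : Set R} {P Q : R[X]} {n : ℕ} (h0 : (0 : R) ∈ A) (hP : P.degree < n)
    (hQ : Q.degree < n) (hPA : cf P ⊆ A) (hQA : cf Q ⊆ A) :
    SLP Ω l w A (n * l) (cf (P - Q)) :=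
  poly h0 ((degree_sub_le _ _).trans_lt (max_lt hP hQ)) fun i _ => by
    rw [coeff_sub]
    exact singleton_sub (hPA ⟨i, rfl⟩) (hQA ⟨i, rfl⟩)

theorem poly_smul {A : Set R} {P : R[X]} {u : R} {n : ℕ} (h0 : (0 : R) ∈ A) (hP : P.degree < n)
    (hu : u ∈ Ω) (hPA : cf P ⊆ A) : SLP Ω l w A (n * l) (cf (C u * P)) :=
  poly h0 (degree_C_mul_lt _ hP) fun i _ => by
    rw [coeff_C_mul]
    exact singleton_smul hu (hPA ⟨i, rfl⟩)

end SLP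

/-! ### Cutting polynomials into blocks and joining them. -/

section cf

variable {R : Type*} [CommRing R]

theorem cf_subset_iff {P : R[X]} {A : Set R} : cf P ⊆ A ↔ ∀ i, P.coeff i ∈ A := by
  simp [cf, Set.range_subset_iff]

theorem cf_zero_subset {A : Set R} (h0 : (0 : R) ∈ A) : cf (0 : R[X]) ⊆ A := by
  simp [cf_subset_iff, h0]

theorem degree_sum_lt {ι : Type*} (s : Finset ι) (P : ι → R[X]) {n : ℕ}
    (h : ∀ i ∈ s, (P i).degree < n) : (∑ i ∈ s, P i).degree < n := by
  rw [← mem_degreeLT]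
  exact Submodule.sum_mem _ fun i hi => mem_degreeLT.mpr (h i hi)

/-- The `j`-th block of length `t` of the coefficients of a polynomial. -/
noncomputable def blk (t j : ℕ) (P : R[X]) : R[X] :=
  ∑ i ∈ Finset.range t, monomial i (P.coeff (t * j + i))

theorem coeff_blk (t j : ℕ) (P : R[X]) (i : ℕ) :
    (blk t j P).coeff i = if i < t then P.coeff (t * j + i) else 0 := by
  simp [blk, coeff_monomial]

theorem degree_blk (t j : ℕ) (P : R[X]) : (blk t j P).degree < t := by
  rw [degree_lt_iff_coeff_zero]
  intro m hm
  rw [coeff_blk, if_neg (by omega)]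

theorem cf_blk {A : Set R} (h0 : (0 : R) ∈ A) {P : R[X]} (hP : cf P ⊆ A) (t j : ℕ) :
    cf (blk t j P) ⊆ A := by
  rw [cf_subset_iff] at *
  intro i
  rw [coeff_blk]
  split_ifs
  exacts [hP _, h0]

/-- Concatenation of blocks of length `t`. -/
noncomputable def joinBlocks (t n : ℕ) (B : ℕ → R[X]) : R[X] :=
  ∑ j ∈ Finset.range n, X ^ (t * j) * B j

theorem coeff_joinBlocks {t n : ℕ} (ht : 0 < t) {B : ℕ → R[X]} (hB : ∀ j < n, (B j).degree < t) (i : ℕ) :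
    (joinBlocks t n B).coeff i = if i < t * n then (B (i / t)).coeff (i % t) else 0 := by
  have key : ∀ j < n, (X ^ (t * j) * B j).coeff i = if j = i / t then (B j).coeff (i % t) else 0 := by
    intro j hj
    have hdm := Nat.div_add_mod i t
    have hml := Nat.mod_lt i ht
    rw [coeff_X_pow_mul']
    split_ifs with h1 h2 h2
    · subst h2
      congr 1
      omega
    · refine (degree_lt_iff_coeff_zero _ _).mp (hB j hj) _ ?_
      have : j ≤ i / t := (Nat.le_div_iff_mul_le ht).mpr (by rwa [mul_comm])
      have h3 : t * (j + 1) ≤ t * (i / t) := Nat.mul_le_mul_left _ (by omega)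
      rw [Nat.mul_succ] at h3
      omega
    · subst h2
      omega
    · rfl
  rw [joinBlocks, finsetSum_coeff, Finset.sum_congr rfl fun j hj => key j (Finset.mem_range.mp hj),
    Finset.sum_ite_eq']
  simp only [Finset.mem_range, Nat.div_lt_iff_lt_mul ht, mul_comm]

theorem degree_joinBlocks {t n : ℕ} (ht : 0 < t) {B : ℕ → R[X]} (hB : ∀ j < n, (B j).degree < t) :
    (joinBlocks t n B).degree < (t * n : ℕ) := by
  rw [degree_lt_iff_coeff_zero]
  intro m hm
  rw [coeff_joinBlocks ht hB, if_neg (by omega)]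

theorem cf_joinBlocks {A : Set R} (h0 : (0 : R) ∈ A) {t n : ℕ} (ht : 0 < t) {B : ℕ → R[X]}
    (hB : ∀ j < n, (B j).degree < t) (hA : ∀ j < n, cf (B j) ⊆ A) : cf (joinBlocks t n B) ⊆ A := by
  rw [cf_subset_iff]
  intro i
  rw [coeff_joinBlocks ht hB]
  split_ifs with h
  · exact hA _ ((Nat.div_lt_iff_lt_mul ht).mpr (by rwa [mul_comm])) ⟨_, rfl⟩
  · exact h0

theorem joinBlocks_blk {t n : ℕ} (ht : 0 < t) {P : R[X]} (hP : P.degree < (t * n : ℕ)) :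
    joinBlocks t n (fun j => blk t j P) = P := by
  ext i
  rw [coeff_joinBlocks ht fun j _ => degree_blk t j P]
  split_ifs with h
  · rw [coeff_blk, if_pos (Nat.mod_lt _ ht), Nat.div_add_mod]
  · exact ((degree_lt_iff_coeff_zero _ _).mp hP _ (by omega)).symm

theorem SLP.poly_lincomb {Ω : Set R} {l w : ℕ} {A : Set R} (h0 : (0 : R) ∈ A) {n : ℕ} (m : ℕ)
    {P : ℕ → R[X]} {u : ℕ → R} (hP : ∀ j < m, (P j).degree < n) (hu : ∀ j < m, u j ∈ Ω)
    (hPA : ∀ j < m, cf (P j) ⊆ A) :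
    SLP Ω l w A (m * (2 * n * l)) (cf (∑ j ∈ Finset.range m, C (u j) * P j)) := by
  induction m with
  | zero => exact .done (by simpa using cf_zero_subset h0)
  | succ m ih =>
    rw [Finset.sum_range_succ]
    have h1 := ih (fun j hj => hP j (by omega)) (fun j hj => hu j (by omega))
      (fun j hj => hPA j (by omega))
    have h2 : SLP Ω l w A (n * l) _ := poly_smul h0 (hP m (by omega)) (hu m (by omega))
      (hPA m (by omega))
    refine ((h1.union h2).trans (poly_add (n := n) (.inl h0) ?_ ?_ ?_ ?_)).mono le_rfl le_rfl
      (by rw [Nat.succ_mul]; linarith)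
    · exact degree_sum_lt _ _ fun j hj =>
        degree_C_mul_lt _ (hP j ((Finset.mem_range.mp hj).trans (by omega)))
    · exact degree_C_mul_lt _ (hP m (by omega))
    · exact Set.subset_union_of_subset_right Set.subset_union_left _
    · exact Set.subset_union_of_subset_right Set.subset_union_right _

end cf

theorem SLP.biUnion_finset {R : Type*} [CommRing R] {Ω : Set R} {l w : ℕ} {A : Set R} {c : ℕ}
    {ι : Type*} (s : Finset ι) (f : ι → Set R) (h : ∀ i ∈ s, SLP Ω l w A c (f i)) :
    SLP Ω l w A (s.card * c) (⋃ i ∈ s, f i) := by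
  classical
  induction s using Finset.induction_on with
  | empty => exact .done (by simp)
  | insert a s ha ih =>
    rw [Finset.card_insert_of_notMem ha, Nat.succ_mul, add_comm, Finset.set_biUnion_insert]
    exact (h a (Finset.mem_insert_self _ _)).union
      (ih fun i hi => h i (Finset.mem_insert_of_mem hi))

/-! ### Chinese remaindering for `Y^p - r^p` over a commutative ring. -/

section idempotents

variable {S : Type*} [CommRing S] {p : ℕ} {h : S} {r ζ : Sˣ}

/-- With `ρ_i = ζ^i r`, the elements `e_i = h ∑_j (Y / ρ_i)^j` are the Lagrange idempotents of the
roots `ρ_i`. Orthogonality makes them sum to `1`, so `P = ∑ e_i P`. This replaces coprimality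
arguments, which are not at hand over a general commutative ring. -/
theorem dvd_of_forall_dvd_geom_sum (hh : h * p = 1)
    (orth : ∀ j < p, ∑ i ∈ Finset.range p, ((ζ ^ (-((i : ℤ) * j)) : Sˣ) : S) =
      if j = 0 then (p : S) else 0) (M Y P : S)
    (H : ∀ i < p, M ∣
      h * (∑ j ∈ Finset.range p, (((ζ ^ i * r)⁻¹ : Sˣ) * Y) ^ j) * P) : M ∣ P := by
  rcases Nat.eq_zero_or_pos p with rfl | hp
  · have : P = 0 := by
      have h1 : (1 : S) = 0 := by simpa using hh.symm
      rw [← one_mul P, h1, zero_mul]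
    simp [this]
  have key : ∑ i ∈ Finset.range p,
      h * (∑ j ∈ Finset.range p, (((ζ ^ i * r)⁻¹ : Sˣ) * Y) ^ j) = 1 := by
    rw [← Finset.mul_sum, Finset.sum_comm]
    have : ∀ j ∈ Finset.range p, ∑ i ∈ Finset.range p, (((ζ ^ i * r)⁻¹ : Sˣ) * Y) ^ j =
        ((r⁻¹ ^ j : Sˣ) : S) * Y ^ j * if j = 0 then (p : S) else 0 := by
      intro j hj
      rw [← orth j (Finset.mem_range.mp hj), Finset.mul_sum]
      refine Finset.sum_congr rfl fun i _ => ?_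
      have : ((ζ ^ i * r)⁻¹) ^ j = r⁻¹ ^ j * ζ ^ (-((i : ℤ) * j)) := by
        rw [mul_inv, mul_pow, mul_comm, zpow_neg, zpow_mul, zpow_natCast, zpow_natCast, inv_pow,
          inv_pow]
      rw [mul_pow, ← Units.val_pow_eq_pow_val, this]
      push_cast
      ring
    rw [Finset.sum_congr rfl this]
    simp only [mul_ite, mul_zero, Finset.sum_ite_eq', Finset.mem_range, hp, if_true]
    simpa using hh
  rw [← one_mul P, ← key, Finset.sum_mul]
  exact Finset.dvd_sum fun i hi => H i (Finset.mem_range.mp hi)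

/-- By the geometric sum, `e_i (Y - ρ_i)` is a multiple of `(Y / ρ_i)^p - 1`, hence of `Y^p - r^p`.
-/
theorem pow_sub_dvd_geom_sum (hζ : ζ ^ p = 1) (Y P : S) (i : ℕ)
    (H : Y - (ζ ^ i * r : Sˣ) ∣ P) : Y ^ p - (r ^ p : Sˣ) ∣
      h * (∑ j ∈ Finset.range p, (((ζ ^ i * r)⁻¹ : Sˣ) * Y) ^ j) * P := by
  obtain ⟨Q, rfl⟩ := H
  set ρ : Sˣ := ζ ^ i * r with hρ
  have hρp : ρ ^ p = r ^ p := by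
    rw [hρ, mul_pow, ← pow_mul, mul_comm i p, pow_mul, hζ, one_pow, one_mul]
  have h1 : (Y - (ρ : S)) = ρ * (((ρ⁻¹ : Sˣ) : S) * Y - 1) := by
    rw [mul_sub, ← mul_assoc, Units.mul_inv]; ring
  have h2 : ((((ρ⁻¹ : Sˣ) : S) * Y) ^ p - 1) = ((ρ⁻¹ ^ p : Sˣ) : S) * (Y ^ p - (r ^ p : Sˣ)) := by
    rw [mul_sub, ← Units.val_mul, ← hρp, ← mul_pow, inv_mul_cancel, one_pow, mul_pow]
    push_cast
    ring
  refine ⟨h * ρ * ((ρ⁻¹ ^ p : Sˣ) : S) * Q, ?_⟩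
  rw [h1]
  have h3 := geom_sum_mul (((ρ⁻¹ : Sˣ) : S) * Y) p
  rw [h2] at h3
  linear_combination h * ρ * Q * h3

theorem pow_sub_pow_dvd (hh : h * p = 1) (hζ : ζ ^ p = 1)
    (orth : ∀ j < p, ∑ i ∈ Finset.range p, ((ζ ^ (-((i : ℤ) * j)) : Sˣ) : S) =
      if j = 0 then (p : S) else 0) (Y P : S)
    (H : ∀ i < p, Y - (ζ ^ i * r : Sˣ) ∣ P) : Y ^ p - (r ^ p : Sˣ) ∣ P :=
  dvd_of_forall_dvd_geom_sum (r := r) hh orth _ Y P fun i hi =>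
    pow_sub_dvd_geom_sum hζ Y P i (H i hi)

/-- The idempotent of the root `1` is itself a multiple of `∑ Y^i`, so nothing has to be known about
`P` at that root. -/
theorem geom_sum_dvd (hh : h * p = 1) (hζ : ζ ^ p = 1)
    (orth : ∀ j < p, ∑ i ∈ Finset.range p, ((ζ ^ (-((i : ℤ) * j)) : Sˣ) : S) =
      if j = 0 then (p : S) else 0) (Y P : S)
    (H : ∀ i < p, i ≠ 0 → Y - (ζ ^ i * 1 : Sˣ) ∣ P) : ∑ i ∈ Finset.range p, Y ^ i ∣ P := by
  refine dvd_of_forall_dvd_geom_sum (r := 1) hh orth _ Y P fun i hi => ?_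
  rcases eq_or_ne i 0 with rfl | h0
  · simp only [pow_zero, mul_one, inv_one, Units.val_one, one_mul]
    exact (Dvd.intro_left _ rfl).mul_right _
  · refine Dvd.dvd.trans ?_ (pow_sub_dvd_geom_sum hζ Y P i (H i hi h0))
    rw [one_pow, Units.val_one, ← geom_sum_mul]
    exact Dvd.intro _ rfl

end idempotents

/-- Products modulo `M` of polynomials of degree `< n` can be computed at the given cost. -/
def MulMod {R : Type*} [CommRing R] (Ω : Set R) (l w : ℕ) (M : R[X]) (n cost : ℕ) : Prop :=
  ∀ A : Set R, 0 ∈ A → ∀ a b : R[X], a.degree < n → b.degree < n → cf a ⊆ A → cf b ⊆ A →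
    ∃ c : R[X], c.degree < n ∧ M ∣ a * b - c ∧ SLP Ω l w A cost (cf c)

/-! ### The radix-`p` fast Fourier transform. -/

section fft

variable {R : Type*} [CommRing R] {Ω : Set R} {l w p : ℕ} {h : R}

/-- The residue of `a` modulo `X ^ t - C ρ`. -/
noncomputable def residue (t p : ℕ) (ρ : R) (a : R[X]) : R[X] :=
  ∑ j ∈ Finset.range p, C (ρ ^ j) * blk t j a

theorem joinBlocks_sub_dvd (t p : ℕ) (ρ : R) (B : ℕ → R[X]) :
    X ^ t - C ρ ∣ joinBlocks t p B - ∑ j ∈ Finset.range p, C (ρ ^ j) * B j := by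
  rw [joinBlocks, ← Finset.sum_sub_distrib]
  refine Finset.dvd_sum fun j _ => ?_
  rw [← sub_mul, pow_mul, C_pow]
  exact (sub_dvd_pow_sub_pow _ _ _).mul_right _

theorem sub_residue_dvd {t : ℕ} (ht : 0 < t) (ρ : R) {a : R[X]} (ha : a.degree < (t * p : ℕ)) :
    X ^ t - C ρ ∣ a - residue t p ρ a := by
  have := joinBlocks_sub_dvd t p ρ fun j => blk t j a
  rwa [joinBlocks_blk ht ha] at this

theorem degree_residue (t p : ℕ) (ρ : R) (a : R[X]) : (residue t p ρ a).degree < t :=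
  degree_sum_lt _ _ fun j _ => degree_C_mul_lt _ (degree_blk t j a)

/-- One FFT layer: the residues modulo `X^t - ρ_i` arise from `X^t ↦ ρ_i` in the block
decomposition, they are multiplied separately, and a length-`p` inverse Fourier transform on blocks
interpolates the results. The set `I` of roots is a parameter because `mulMod_phi` leaves out the
root `1`. -/
theorem exists_mul_residues {t : ℕ} (ht : 0 < t) (hh : h * p = 1) (hΩ : h ∈ Ω) (r ζ : Rˣ)
    (hrζ : ∀ a b : ℤ, ((r ^ a * ζ ^ b : Rˣ) : R) ∈ Ω)
    (orth : ∀ i < p, ∀ i' < p, ∑ j ∈ Finset.range p, ((ζ ^ (((i : ℤ) - i') * j) : Rˣ) : R) =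
      if i = i' then (p : R) else 0)
    (I : Finset ℕ) (hI : ∀ i ∈ I, i < p) {w' : ℕ}
    (child : ∀ i ∈ I, MulMod Ω l w (X ^ t - C ((ζ ^ i * r : Rˣ) : R)) t w')
    (A : Set R) (h0 : 0 ∈ A) (a b : R[X]) (ha : a.degree < (t * p : ℕ))
    (hb : b.degree < (t * p : ℕ)) (haA : cf a ⊆ A) (hbA : cf b ⊆ A) :
    ∃ c : R[X], c.degree < (t * p : ℕ) ∧
      (∀ i ∈ I, X ^ t - C ((ζ ^ i * r : Rˣ) : R) ∣ a * b - c) ∧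
      SLP Ω l w A (I.card * w' + 7 * p * p * t * l) (cf c) := by
  classical
  set ρ : ℕ → Rˣ := fun i => ζ ^ i * r with hρ
  have hρj : ∀ i j, ((ρ i : R)) ^ j ∈ Ω := by
    intro i j
    have := hrζ j ((i : ℤ) * j)
    rwa [zpow_mul, zpow_natCast, zpow_natCast, zpow_natCast, mul_comm, ← mul_pow,
      Units.val_pow_eq_pow_val] at this
  have hres : ∀ i, ∀ a : R[X], cf a ⊆ A →
      SLP Ω l w A (p * (2 * t * l)) (cf (residue t p (ρ i : R) a)) := fun i a haA =>
    SLP.poly_lincomb h0 p (fun j _ => degree_blk t j a) (fun j _ => hρj i j)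
      (fun j _ => cf_blk h0 haA t j)
  -- Outside `I` the residue is set to `0`: the interpolation needs `p` values, but only those at
  -- `I` matter.
  have hch : ∀ i, ∃ c : R[X], c.degree < t ∧ (i ∈ I → X ^ t - C ((ρ i : Rˣ) : R) ∣ a * b - c) ∧
      (i ∉ I → c = 0) ∧ (i ∈ I → SLP Ω l w A (4 * p * t * l + w') (cf c)) := by
    intro i
    by_cases hi : i ∈ I
    · obtain ⟨c, hc, hd, hs⟩ := child i hi
        (A ∪ (cf (residue t p (ρ i : R) a) ∪ cf (residue t p (ρ i : R) b))) (.inl h0)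
        (residue t p (ρ i : R) a) (residue t p (ρ i : R) b) (degree_residue _ _ _ _)
        (degree_residue _ _ _ _) (Set.subset_union_of_subset_right Set.subset_union_left _)
        (Set.subset_union_of_subset_right Set.subset_union_right _)
      refine ⟨c, hc, fun _ => ?_, fun h => absurd hi h, fun _ => ?_⟩
      · have h1 := sub_residue_dvd (p := p) ht (ρ i : R) ha
        have h2 := sub_residue_dvd (p := p) ht (ρ i : R) hb
        have h3 : a * b - c = (a - residue t p (ρ i : R) a) * b +
          residue t p (ρ i : R) a * (b - residue t p (ρ i : R) b) +
          (residue t p (ρ i : R) a * residue t p (ρ i : R) b - c) := by ring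
        rw [h3]
        exact dvd_add (dvd_add (h1.mul_right _) (h2.mul_left _)) hd
      · exact (((hres i a haA).union (hres i b hbA)).trans hs).mono le_rfl le_rfl
          (by ring_nf; rfl)
    · exact ⟨0, by simp, fun h => absurd h hi, fun _ => rfl, fun h => absurd h hi⟩
  choose c hcdeg hcdvd hc0 hcs using hch
  -- Inverse Fourier transform: `d j = h ∑_i ρ_i^(-j) c_i`.
  set d : ℕ → R[X] := fun j => C h *
    ∑ i ∈ Finset.range p, C ((r ^ (-(j : ℤ)) * ζ ^ (-((i : ℤ) * j)) : Rˣ) : R) * c i with hd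
  have hddeg : ∀ j, (d j).degree < t := fun j =>
    degree_C_mul_lt _ (degree_sum_lt _ _ fun i _ => degree_C_mul_lt _ (hcdeg i))
  refine ⟨joinBlocks t p d, degree_joinBlocks ht fun j _ => hddeg j, fun i hi => ?_, ?_⟩
  · have h1 := joinBlocks_sub_dvd t p ((ρ i : Rˣ) : R) d
    have h2 : ∑ j ∈ Finset.range p, C (((ρ i : Rˣ) : R) ^ j) * d j = c i := by
      have h3 : ∀ j ∈ Finset.range p, C (((ρ i : Rˣ) : R) ^ j) * d j =
          ∑ i' ∈ Finset.range p, C h * C ((ζ ^ (((i : ℤ) - i') * j) : Rˣ) : R) * c i' := by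
        intro j _
        rw [hd]
        simp only [Finset.mul_sum]
        refine Finset.sum_congr rfl fun i' _ => ?_
        rw [mul_left_comm, ← mul_assoc (C (_ ^ j)), ← C_mul, ← Units.val_pow_eq_pow_val,
          ← Units.val_mul, mul_assoc (C h)]
        have : ρ i ^ j * (r ^ (-(j : ℤ)) * ζ ^ (-((i' : ℤ) * j))) = ζ ^ (((i : ℤ) - i') * j) := by
          rw [hρ]
          simp only
          rw [mul_pow, ← pow_mul, ← zpow_natCast, ← zpow_natCast r, mul_assoc,
            ← mul_assoc (r ^ _), ← zpow_add, add_neg_cancel, zpow_zero, one_mul, ← zpow_add]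
          congr 1
          push_cast
          ring
        rw [this]
      rw [Finset.sum_congr rfl h3, Finset.sum_comm]
      have h4 : ∀ i' ∈ Finset.range p,
          ∑ j ∈ Finset.range p, C h * C ((ζ ^ (((i : ℤ) - i') * j) : Rˣ) : R) * c i' =
            if i = i' then c i' else 0 := by
        intro i' hi'
        rw [← Finset.sum_mul, ← Finset.mul_sum, ← map_sum,
          orth i (hI i hi) i' (Finset.mem_range.mp hi'), ← C_mul]
        split_ifs with h5
        · rw [hh, C_1, one_mul]
        · simp
      rw [Finset.sum_congr rfl h4, Finset.sum_ite_eq, if_pos (Finset.mem_range.mpr (hI i hi))]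
    rw [h2] at h1
    have h3 : a * b - joinBlocks t p d = (a * b - c i) - (joinBlocks t p d - c i) := by ring
    rw [h3]
    exact dvd_sub (hcdvd i hi) h1
  · have s1 := SLP.biUnion_finset I (fun i => cf (c i)) fun i hi => hcs i hi
    set B := ⋃ i ∈ I, cf (c i) with hB
    have h0B : (0 : R) ∈ A ∪ B := .inl h0
    have hcB : ∀ i, cf (c i) ⊆ A ∪ B := by
      intro i
      by_cases hi : i ∈ I
      · exact Set.subset_union_of_subset_right (Set.subset_biUnion_of_mem (u := fun i => cf (c i)) hi) _
      · rw [hc0 i hi]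
        exact cf_zero_subset h0B
    have s2 : ∀ j < p, SLP Ω l w (A ∪ B) (p * (2 * t * l) + t * l) (cf (d j)) := by
      intro j _
      have := SLP.poly_lincomb (l := l) (w := w) (Ω := Ω) h0B (n := t) p (P := c)
        (u := fun i => ((r ^ (-(j : ℤ)) * ζ ^ (-((i : ℤ) * j)) : Rˣ) : R)) (fun i _ => hcdeg i)
        (fun i _ => hrζ _ _) (fun i _ => hcB i)
      refine this.trans (SLP.poly_smul (.inl h0B) ?_ hΩ Set.subset_union_right)
      exact degree_sum_lt _ _ fun i _ => degree_C_mul_lt _ (hcdeg i)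
    have s3 := SLP.biUnion (fun j => cf (d j)) p s2
    refine (s1.trans s3.frame).mono le_rfl
      (cf_joinBlocks (.inl h0B) ht (fun j _ => hddeg j) fun j hj => ?_) ?_
    · exact fun x hx => .inr (Set.mem_biUnion (x := j) hj hx)
    · have hIp : I.card ≤ p := by
        simpa using Finset.card_le_card (fun i hi => Finset.mem_range.mpr (hI i hi))
      have hp : p ≤ p * p := Nat.le_mul_self p
      calc I.card * (4 * p * t * l + w') + p * (p * (2 * t * l) + t * l)
          = I.card * w' + (I.card * (4 * p * t * l) + 2 * (p * p) * (t * l) + p * (t * l)) := by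
            ring
        _ ≤ I.card * w' + (p * (4 * p * t * l) + 2 * (p * p) * (t * l) + (p * p) * (t * l)) := by
            gcongr
        _ = _ := by ring

variable (p) in
/-- Orthogonality of the powers of a root of unity `ζ` of order `p`. -/
def RootOrth (ζ : Rˣ) : Prop :=
  ∀ i < p, ∀ i' < p, ∑ j ∈ Finset.range p, ((ζ ^ (((i : ℤ) - i') * j) : Rˣ) : R) =
    if i = i' then (p : R) else 0

theorem RootOrth.orth_C {ζ : Rˣ} (orth : RootOrth p ζ) (j : ℕ) (hj : j < p) :
    ∑ i ∈ Finset.range p, (((Units.map (C : R →+* R[X]).toMonoidHom ζ) ^ (-((i : ℤ) * j)) :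
      R[X]ˣ) : R[X]) = if j = 0 then (p : R[X]) else 0 := by
  have h1 := congrArg C (orth 0 (by omega) j hj)
  rw [map_sum] at h1
  simp only [Nat.cast_zero, zero_sub] at h1
  refine Eq.trans (Finset.sum_congr rfl fun i _ => ?_) (h1.trans ?_)
  · rw [← map_zpow, neg_mul, mul_comm]
    rfl
  · simp only [eq_comm (a := 0)]
    split_ifs <;> simp

/-- Multiplication modulo `X ^ (p ^ k) - C (ω ^ (e * p ^ k))`. -/
theorem mulMod_fft (hp : 0 < p) (hh : h * p = 1) (hΩ : h ∈ Ω) (ω : Rˣ)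
    (hω : ∀ e : ℤ, ((ω ^ e : Rˣ) : R) ∈ Ω) (K : ℕ) (hζ : (ω ^ (p ^ K)) ^ p = 1)
    (orth : RootOrth p (ω ^ (p ^ K))) (k : ℕ) (hk : k ≤ K + 1) (e : ℤ) :
    MulMod Ω l w (X ^ (p ^ k) - C ((ω ^ (e * p ^ k) : Rˣ) : R)) (p ^ k)
      (p ^ k * w + 7 * p * k * p ^ k * l) := by
  induction k generalizing e with
  | zero =>
    intro A h0 a b ha hb haA hbA
    have e1 : ∀ P : R[X], P.degree < (p ^ 0 : ℕ) → P = C (P.coeff 0) := fun P hP => by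
      refine eq_C_of_degree_le_zero ?_
      rw [pow_zero] at hP
      exact Nat.WithBot.lt_one_iff_le_zero.mp (by simpa using hP)
    refine ⟨C (a.coeff 0 * b.coeff 0), ?_, ?_, ?_⟩
    · exact degree_C_lt.trans_le (by simp)
    · rw [e1 a ha, e1 b hb]
      simp
    · refine (SLP.singleton_mul (haA ⟨0, rfl⟩) (hbA ⟨0, rfl⟩)).frame.mono le_rfl ?_ (by simp)
      rw [cf_subset_iff]
      intro i
      rw [coeff_C]
      split_ifs
      · exact .inr rfl
      · exact .inl h0
  | succ k ih =>
    intro A h0 a b ha hb haA hbA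
    set ζ := ω ^ (p ^ K) with hζdef
    have ht : 0 < p ^ k := pow_pos hp k
    have hsub : p ^ K = p ^ (K - k) * p ^ k := by rw [← pow_add]; congr 1; omega
    -- The factors of `X^(p^(k+1)) - ω^(e p^(k+1))` are again of the form `X^(p^k) - ω^(e' p^k)`,
    -- because `k ≤ K` makes `ζ = ω^(p^K)` a power of `ω^(p^k)`. So the recursion closes with powers
    -- of `ω` as its only roots.
    have hroot : ∀ i : ℕ, ζ ^ i * ω ^ (e * (p : ℤ) ^ k) =
        ω ^ ((e + i * (p : ℤ) ^ (K - k)) * (p : ℤ) ^ k) := by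
      intro i
      rw [hζdef, ← pow_mul, ← zpow_natCast, ← zpow_add, hsub]
      congr 1
      push_cast
      ring
    obtain ⟨c, hc, hd, hs⟩ := exists_mul_residues (l := l) (w := w) ht hh hΩ
      (ω ^ (e * (p : ℤ) ^ k)) ζ
      (fun a b => by
        rw [hζdef, ← zpow_natCast ω, ← zpow_mul, ← zpow_mul, ← zpow_add]
        exact hω _) orth (Finset.range p) (fun i hi => Finset.mem_range.mp hi)
      (w' := p ^ k * w + 7 * p * k * p ^ k * l)
      (fun i _ => by rw [hroot]; exact ih (by omega) _) A h0 a b (by rwa [← pow_succ])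
      (by rwa [← pow_succ]) haA hbA
    refine ⟨c, by rwa [pow_succ], ?_, hs.mono le_rfl le_rfl ?_⟩
    · have := pow_sub_pow_dvd (p := p) (h := C h) (r := Units.map (C : R →+* R[X]).toMonoidHom
        (ω ^ (e * (p : ℤ) ^ k))) (ζ := Units.map (C : R →+* R[X]).toMonoidHom ζ)
        (by rw [← C_eq_natCast, ← C_mul, hh, C_1]) (by rw [← map_pow, hζ, map_one])
        orth.orth_C (X ^ p ^ k) (a * b - c) (fun i hi => by
          have := hd i (Finset.mem_range.mpr hi)
          rw [← map_pow, ← map_mul]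
          exact this)
      rw [← pow_mul, ← pow_succ, ← map_pow, ← zpow_natCast, ← zpow_mul, mul_assoc, ← pow_succ]
        at this
      exact this
    · rw [Finset.card_range]
      apply le_of_eq
      ring

/-- The polynomial `1 + X ^ t + ⋯ + X ^ (t * (p - 1))`. -/
noncomputable def phi (R : Type*) [CommRing R] (p t : ℕ) : R[X] :=
  ∑ i ∈ Finset.range p, X ^ (t * i)

/-- Multiplication modulo `phi R p (p ^ k)`, with `p - 1` multiplications modulo binomials. -/
theorem mulMod_phi (hp : 0 < p) (hh : h * p = 1) (hΩ : h ∈ Ω) (ω : Rˣ)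
    (hω : ∀ e : ℤ, ((ω ^ e : Rˣ) : R) ∈ Ω) (K : ℕ) (hζ : (ω ^ (p ^ K)) ^ p = 1)
    (orth : RootOrth p (ω ^ (p ^ K))) (k : ℕ) (hk : k ≤ K) :
    MulMod Ω l w (phi R p (p ^ k)) (p ^ k * p)
      ((p - 1) * (p ^ k * w + 7 * p * k * p ^ k * l) + 7 * p * p * p ^ k * l) := by
  intro A h0 a b ha hb haA hbA
  set ζ := ω ^ (p ^ K) with hζdef
  have ht : 0 < p ^ k := pow_pos hp k
  have hsub : p ^ K = p ^ (K - k) * p ^ k := by rw [← pow_add]; congr 1; omega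
  have hroot : ∀ i : ℕ, ζ ^ i * 1 = ω ^ ((i * (p : ℤ) ^ (K - k)) * (p : ℤ) ^ k) := by
    intro i
    rw [mul_one, hζdef, ← pow_mul, ← zpow_natCast, hsub]
    congr 1
    push_cast
    ring
  obtain ⟨c, hc, hd, hs⟩ := exists_mul_residues (l := l) (w := w) ht hh hΩ 1 ζ
    (fun a b => by
      rw [hζdef, ← zpow_natCast ω, ← zpow_mul, one_zpow, one_mul]
      exact hω _) orth ((Finset.range p).erase 0)
    (fun i hi => Finset.mem_range.mp (Finset.mem_of_mem_erase hi))
    (w' := p ^ k * w + 7 * p * k * p ^ k * l)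
    (fun i _ => by
      rw [hroot]
      exact mulMod_fft hp hh hΩ ω hω K hζ orth k (by omega) _) A h0 a b ha hb haA hbA
  refine ⟨c, hc, ?_, hs.mono le_rfl le_rfl ?_⟩
  · have := geom_sum_dvd (p := p) (h := C h) (ζ := Units.map (C : R →+* R[X]).toMonoidHom ζ)
      (by rw [← C_eq_natCast, ← C_mul, hh, C_1]) (by rw [← map_pow, hζ, map_one])
      orth.orth_C (X ^ p ^ k) (a * b - c) (fun i hi hi0 => by
        have := hd i (Finset.mem_erase.mpr ⟨hi0, Finset.mem_range.mpr hi⟩)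
        rw [← map_pow, mul_one]
        rw [mul_one] at this
        exact this)
    simpa only [phi, pow_mul] using this
  · rw [Finset.card_erase_of_mem (Finset.mem_range.mpr hp), Finset.card_range]

end fft

/-! ### Arithmetic modulo `1 + X^t + ⋯ + X^(t(p-1))`. -/

section phi

variable {R : Type*} [CommRing R] {p : ℕ}

theorem phi_eq_expand (hp : p.Prime) (t : ℕ) : phi R p t = expand R t (cyclotomic p R) := by
  have := Fact.mk hp
  simp [cyclotomic_prime, phi, pow_mul]

theorem phi_monic (hp : p.Prime) {t : ℕ} (ht : 0 < t) : (phi R p t).Monic := by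
  rw [phi_eq_expand hp]
  exact (cyclotomic.monic p R).expand ht

theorem degree_phi [Nontrivial R] (hp : p.Prime) {t : ℕ} (ht : 0 < t) :
    (phi R p t).degree = ((p - 1) * t : ℕ) := by
  rw [degree_eq_natDegree (phi_monic hp ht).ne_zero, phi_eq_expand hp, natDegree_expand,
    natDegree_cyclotomic, Nat.totient_prime hp]

theorem map_phi {S : Type*} [CommRing S] (f : R →+* S) (t : ℕ) :
    (phi R p t).map f = phi S p t := by
  simp [phi, Polynomial.map_sum]

theorem phi_dvd (t : ℕ) : phi R p t ∣ X ^ (t * p) - 1 := by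
  have := geom_sum_mul (X ^ t : R[X]) p
  simp only [← pow_mul] at this
  rw [← this]
  exact Dvd.intro _ rfl

/-- Modulo `phi` the power `X^(t(p-1))` is minus the sum of the lower powers `X^(tj)`, so the top
block is subtracted from each other block. -/
theorem modByMonic_phi [Nontrivial R] (hp : p.Prime) {t : ℕ} (ht : 0 < t) {c : R[X]}
    (hc : c.degree < (t * p : ℕ)) :
    c %ₘ phi R p t = joinBlocks t (p - 1) fun j => blk t j c - blk t (p - 1) c := by
  refine (div_modByMonic_unique (blk t (p - 1) c) _ (phi_monic hp ht) ⟨?_, ?_⟩).2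
  · obtain ⟨q, rfl⟩ := Nat.exists_eq_succ_of_ne_zero hp.ne_zero
    conv_rhs => rw [← joinBlocks_blk ht hc]
    simp only [joinBlocks, phi, Nat.succ_eq_add_one, Nat.add_sub_cancel, mul_sub,
      Finset.sum_sub_distrib, Finset.sum_range_succ, add_mul, Finset.sum_mul]
    ring
  · rw [degree_phi hp ht, mul_comm]
    exact degree_joinBlocks ht fun j _ =>
      (degree_sub_le _ _).trans_lt (max_lt (degree_blk _ _ _) (degree_blk _ _ _))

theorem SLP.modByMonic_phi {Ω : Set R} {l w : ℕ} (hp : p.Prime) {t : ℕ} (ht : 0 < t) {c : R[X]}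
    (hc : c.degree < (t * p : ℕ)) {A : Set R} (h0 : 0 ∈ A) (hA : cf c ⊆ A) :
    SLP Ω l w A (p * (t * l)) (cf (c %ₘ phi R p t)) := by
  rcases subsingleton_or_nontrivial R with hR | hR
  · exact .done fun x _ => by rwa [Subsingleton.elim x 0]
  rw [_root_.modByMonic_phi hp ht hc]
  have h1 := SLP.biUnion (Ω := Ω) (l := l) (w := w) (A := A)
    (fun j => cf (blk t j c - blk t (p - 1) c)) (p - 1) fun j _ =>
      SLP.poly_sub h0 (degree_blk _ _ _) (degree_blk _ _ _) (cf_blk h0 hA _ _) (cf_blk h0 hA _ _)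
  refine h1.frame.mono le_rfl (cf_joinBlocks (.inl h0) ht (fun j _ => ?_) fun j hj x hx => ?_)
    (Nat.mul_le_mul_right _ (Nat.sub_le _ _))
  · exact (degree_sub_le _ _).trans_lt (max_lt (degree_blk _ _ _) (degree_blk _ _ _))
  · exact .inr (Set.mem_biUnion (x := j) hj hx)

/-- The vanishing geometric sum gives `ζ^p = 1`, so exponents count modulo `p`; as `p` is prime, a
nonzero difference `i - i'` merely permutes the terms of that sum. -/
theorem RootOrth.of_geom_sum (hp : p = 2 ∨ p = 3) {ζ : Rˣ}
    (hζ : ∑ i ∈ Finset.range p, (ζ : R) ^ i = 0) : RootOrth p ζ := by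
  have h1 : ζ ^ p = 1 := by
    ext
    have := geom_sum_mul (ζ : R) p
    rw [hζ, zero_mul] at this
    push_cast
    exact (sub_eq_zero.mp this.symm)
  intro i hi i' hi'
  have h2 : ∀ z : ℤ, ζ ^ z = ζ ^ (z % p) := fun z => zpow_eq_zpow_emod z h1
  have h3 : ∀ j, ((ζ ^ (((i : ℤ) - i') * j) : Rˣ) : R) = (ζ : R) ^ ((((i : ℤ) - i') * j % p).toNat) := by
    intro j
    rw [h2, ← Units.val_pow_eq_pow_val, ← zpow_natCast, Int.toNat_of_nonneg]
    exact Int.emod_nonneg _ (by omega)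
  simp only [h3]
  rcases hp with rfl | rfl
  · simp only [Finset.sum_range_succ, Finset.sum_range_zero] at hζ ⊢
    interval_cases i <;> interval_cases i' <;> norm_num at hζ ⊢ <;> exact hζ
  · simp only [Finset.sum_range_succ, Finset.sum_range_zero] at hζ ⊢
    interval_cases i <;> interval_cases i' <;> norm_num at hζ ⊢ <;>
      (try rw [show Int.toNat 2 = 2 from rfl]) <;> linear_combination hζ

end phi

/-! ### Simulating computations in `V[X] / ψ` by computations in `V`. -/

section simulation

variable {V : Type*} [CommRing V]

/-- The elements of `V[X] / ψ` with a representative of degree `< n` with coefficients in `A`. -/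
def Available (ψ : V[X]) (n : ℕ) (A : Set V) : Set (AdjoinRoot ψ) :=
  {d | ∃ P : V[X], P.degree < n ∧ cf P ⊆ A ∧ AdjoinRoot.mk ψ P = d}

theorem Available.mono {ψ : V[X]} {n : ℕ} {A B : Set V} (h : A ⊆ B) :
    Available ψ n A ⊆ Available ψ n B :=
  fun _ ⟨P, hP, hA, he⟩ => ⟨P, hP, hA.trans h, he⟩

theorem SLP.lift_step {Ω : Set V} {ψ : V[X]} {n : ℕ} {𝒜 ℬ : Set (AdjoinRoot ψ)} {c d : ℕ}
    {z : AdjoinRoot ψ} {A : Set V} (h0 : 0 ∈ A) (h𝒜 : 𝒜 ⊆ Available ψ n A)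
    (hz : ∃ Q : V[X], Q.degree < n ∧ AdjoinRoot.mk ψ Q = z ∧ SLP Ω 1 1 A d (cf Q))
    (ih : ∀ A : Set V, 0 ∈ A → insert z 𝒜 ⊆ Available ψ n A →
      ∃ B, SLP Ω 1 1 A c B ∧ ℬ ⊆ Available ψ n (A ∪ B)) :
    ∃ B, SLP Ω 1 1 A (c + d) B ∧ ℬ ⊆ Available ψ n (A ∪ B) := by
  obtain ⟨Q, hQ, rfl, hs⟩ := hz
  obtain ⟨B, hB, hB'⟩ := ih (A ∪ cf Q) (.inl h0) (Set.insert_subset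
    ⟨Q, hQ, Set.subset_union_right, rfl⟩ (h𝒜.trans (Available.mono Set.subset_union_left)))
  exact ⟨cf Q ∪ B, (hs.seq hB).mono le_rfl le_rfl (by omega), by rwa [← Set.union_assoc]⟩

/-- A straight-line computation in `V[X] / ψ` is carried out on representatives. -/
theorem SLP.lift {Ω : Set V} {ψ : V[X]} {n W : ℕ} (hmul : MulMod Ω 1 1 ψ n W)
    {ΩD : Set (AdjoinRoot ψ)}
    (hΩ : ∀ u ∈ ΩD, ∀ A : Set V, 0 ∈ A → ∀ P : V[X], P.degree < n → cf P ⊆ A →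
      ∃ Q : V[X], Q.degree < n ∧ AdjoinRoot.mk ψ Q = u * AdjoinRoot.mk ψ P ∧
        SLP Ω 1 1 A n (cf Q))
    {𝒜 ℬ : Set (AdjoinRoot ψ)} {c : ℕ} (h : SLP ΩD n W 𝒜 c ℬ) :
    ∀ A : Set V, 0 ∈ A → 𝒜 ⊆ Available ψ n A →
      ∃ B, SLP Ω 1 1 A c B ∧ ℬ ⊆ Available ψ n (A ∪ B) := by
  induction h with
  | done h =>
    exact fun A _ h𝒜 => ⟨∅, .done (Set.empty_subset _), by simpa using h.trans h𝒜⟩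
  | add hx hy _ ih =>
    intro A h0 h𝒜
    obtain ⟨P, hP, hPA, rfl⟩ := h𝒜 hx
    obtain ⟨Q, hQ, hQA, rfl⟩ := h𝒜 hy
    exact SLP.lift_step h0 h𝒜 ⟨P + Q, (degree_add_le _ _).trans_lt (max_lt hP hQ), map_add _ _ _,
      by simpa using SLP.poly_add (Ω := Ω) (l := 1) (w := 1) h0 hP hQ hPA hQA⟩ ih
  | sub hx hy _ ih =>
    intro A h0 h𝒜
    obtain ⟨P, hP, hPA, rfl⟩ := h𝒜 hx
    obtain ⟨Q, hQ, hQA, rfl⟩ := h𝒜 hy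
    exact SLP.lift_step h0 h𝒜 ⟨P - Q, (degree_sub_le _ _).trans_lt (max_lt hP hQ), map_sub _ _ _,
      by simpa using SLP.poly_sub (Ω := Ω) (l := 1) (w := 1) h0 hP hQ hPA hQA⟩ ih
  | smul hx hy _ ih =>
    intro A h0 h𝒜
    obtain ⟨Q, hQ, hQA, rfl⟩ := h𝒜 hy
    exact SLP.lift_step h0 h𝒜 (hΩ _ hx A h0 Q hQ hQA) ih
  | mul hx hy _ ih =>
    intro A h0 h𝒜
    obtain ⟨P, hP, hPA, rfl⟩ := h𝒜 hx
    obtain ⟨Q, hQ, hQA, rfl⟩ := h𝒜 hy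
    obtain ⟨c, hc, hd, hs⟩ := hmul A h0 P Q hP hQ hPA hQA
    refine SLP.lift_step h0 h𝒜 ⟨c, hc, ?_, hs⟩ ih
    rw [← map_mul, eq_comm, AdjoinRoot.mk_eq_mk]
    exact hd

/-- Representatives of degree `< n`, not reduced modulo `ψ`, are used because `ψ ∣ X^n - 1` turns
multiplication by `X` into a rotation of coefficients. Multiplying by powers of the root of unity is
therefore free. -/
theorem exists_rotate {ψ : V[X]} {n : ℕ} (hn : 0 < n) (hψ : ψ ∣ X ^ n - 1) {A : Set V}
    (h0 : 0 ∈ A) {P : V[X]} (hP : P.degree < n) (hPA : cf P ⊆ A) (e : ℕ) :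
    ∃ Q : V[X], Q.degree < n ∧ cf Q ⊆ A ∧
      AdjoinRoot.mk ψ Q = AdjoinRoot.mk ψ X ^ e * AdjoinRoot.mk ψ P := by
  induction e with
  | zero => exact ⟨P, hP, hPA, by simp⟩
  | succ e ih =>
    obtain ⟨Q, hQ, hQA, he⟩ := ih
    rw [degree_lt_iff_coeff_zero] at hQ
    rw [cf_subset_iff] at hQA
    have hco : ∀ i, (X * Q - C (Q.coeff (n - 1)) * (X ^ n - 1)).coeff i =
        if i = 0 then Q.coeff (n - 1) else if i < n then Q.coeff (i - 1) else 0 := by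
      intro i
      rw [coeff_sub, coeff_C_mul, coeff_sub, coeff_X_pow, coeff_one]
      rcases i with _ | i
      · simp [hn.ne]
      · rw [coeff_X_mul]
        rcases lt_trichotomy (i + 1) n with h | h | h
        · simp [h.ne, h]
        · simp [← h]
        · simp [h.ne', not_lt_of_gt h, hQ i (by omega)]
    refine ⟨X * Q - C (Q.coeff (n - 1)) * (X ^ n - 1), ?_, ?_, ?_⟩
    · rw [degree_lt_iff_coeff_zero]
      intro i hi
      rw [hco, if_neg (by omega), if_neg (by omega)]
    · rw [cf_subset_iff]
      intro i
      rw [hco]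
      split_ifs
      exacts [hQA _, hQA _, h0]
    · rw [map_sub, map_mul, map_mul, AdjoinRoot.mk_eq_zero.mpr hψ, mul_zero, sub_zero, he]
      ring

end simulation

/-! ### Chunks of a polynomial and their recombination. -/

section chunk

variable {V : Type*} [CommRing V]

/-- Splitting a polynomial into `q` chunks of length `m`, as a polynomial over `V[X]`. -/
noncomputable def chunk (m q : ℕ) (a : V[X]) : V[X][X] :=
  ∑ j ∈ Finset.range q, monomial j (blk m j a)

theorem coeff_chunk (m q : ℕ) (a : V[X]) (j : ℕ) :
    (chunk m q a).coeff j = if j < q then blk m j a else 0 := by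
  simp [chunk, coeff_monomial]

theorem eval_chunk {m q : ℕ} (hm : 0 < m) {a : V[X]} (ha : a.degree < (m * q : ℕ)) :
    (chunk m q a).eval (X ^ m) = a := by
  conv_rhs => rw [← joinBlocks_blk hm ha]
  simp [chunk, joinBlocks, eval_finsetSum, eval_monomial, pow_mul, mul_comm]

theorem degree_coeff_chunk (m q : ℕ) (a : V[X]) (j : ℕ) : ((chunk m q a).coeff j).degree < m := by
  rw [coeff_chunk]
  split_ifs
  · exact degree_blk _ _ _
  · rw [degree_zero]
    exact WithBot.bot_lt_coe m

theorem degree_mul_lt_add {P Q : V[X]} {m n : ℕ} (hP : P.degree < m) (hQ : Q.degree < n) :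
    (P * Q).degree < (m + n : ℕ) := by
  rw [degree_lt_iff_coeff_zero] at *
  intro i hi
  rw [coeff_mul]
  refine Finset.sum_eq_zero fun x hx => ?_
  rw [Finset.HasAntidiagonal.mem_antidiagonal] at hx
  rcases le_or_gt m x.1 with h | h
  · rw [hP _ h, zero_mul]
  · rw [hQ _ (by omega), mul_zero]

theorem degree_coeff_mul_lt {P Q : V[X][X]} {m n : ℕ} (hP : ∀ j, (P.coeff j).degree < m)
    (hQ : ∀ j, (Q.coeff j).degree < n) (j : ℕ) : ((P * Q).coeff j).degree < (m + n : ℕ) := by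
  rw [coeff_mul]
  exact degree_sum_lt _ _ fun x _ => degree_mul_lt_add (hP _) (hQ _)

/-- The modulus has constant coefficients, so reduction in the outer variable forms `V`-linear
combinations of the coefficients and cannot raise their degree in the inner variable. -/
theorem degree_coeff_modByMonic_lt {M : V[X]} (hM : M.Monic) {P : V[X][X]} {n : ℕ}
    (hP : ∀ j, (P.coeff j).degree < n) (j : ℕ) : ((P %ₘ M.map C).coeff j).degree < n := by
  have h1 : P %ₘ M.map C = ∑ i ∈ Finset.range (P.natDegree + 1),
      P.coeff i • (X ^ i %ₘ M).map C := by
    conv_lhs => rw [P.as_sum_range_C_mul_X_pow]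
    change modByMonicHom _ _ = _
    rw [map_sum]
    refine Finset.sum_congr rfl fun i _ => ?_
    rw [← smul_eq_C_mul, map_smul, map_modByMonic C hM, Polynomial.map_pow, map_X]
    rfl
  rw [h1, finsetSum_coeff]
  refine degree_sum_lt _ _ fun i _ => ?_
  rw [coeff_smul, coeff_map, smul_eq_mul, mul_comm]
  exact degree_C_mul_lt _ (hP i)

theorem sum_range_two_mul {M : Type*} [AddCommMonoid M] (f : ℕ → M) (n : ℕ) :
    ∑ j ∈ Finset.range (2 * n), f j =
      ∑ i ∈ Finset.range n, f (2 * i) + ∑ i ∈ Finset.range n, f (2 * i + 1) := by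
  induction n with
  | zero => simp
  | succ n ih =>
    rw [Nat.mul_succ, Finset.sum_range_succ, Finset.sum_range_succ, ih, Finset.sum_range_succ,
      Finset.sum_range_succ]
    abel

/-- Adding up shifted polynomials of length `2 * m` costs one addition for each coefficient. -/
theorem SLP.overlap {Ω : Set V} {l w : ℕ} {A : Set V} (h0 : 0 ∈ A) {m : ℕ} (hm : 0 < m) (J : ℕ)
    (R : ℕ → V[X]) (hR : ∀ j, (R j).degree < (2 * m : ℕ)) (hRA : ∀ j, cf (R j) ⊆ A) {n : ℕ}
    (hn : (∑ j ∈ Finset.range (2 * J), X ^ (m * j) * R j).degree < (n : WithBot ℕ)) :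
    SLP Ω l w A (n * l) (cf (∑ j ∈ Finset.range (2 * J), X ^ (m * j) * R j)) := by
  have h2m : 0 < 2 * m := by omega
  -- The terms of even index occupy disjoint ranges, and so do those of odd index; hence each
  -- coefficient is a sum of two available values.
  have he : ∑ j ∈ Finset.range (2 * J), X ^ (m * j) * R j =
      joinBlocks (2 * m) J (fun i => R (2 * i)) +
        X ^ m * joinBlocks (2 * m) J (fun i => R (2 * i + 1)) := by
    rw [sum_range_two_mul, joinBlocks, joinBlocks, Finset.mul_sum]
    congr 1 <;> refine Finset.sum_congr rfl fun i _ => ?_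
    · congr 2; ring
    · rw [← mul_assoc, ← pow_add]; congr 2; ring
  refine SLP.poly h0 hn fun i _ => ?_
  rw [he, coeff_add]
  refine SLP.singleton_add ?_ ?_
  · exact cf_joinBlocks h0 h2m (fun j _ => hR _) (fun j _ => hRA _) ⟨i, rfl⟩
  · rw [coeff_X_pow_mul']
    split_ifs
    · exact cf_joinBlocks h0 h2m (fun j _ => hR _) (fun j _ => hRA _) ⟨_, rfl⟩
    · exact h0

end chunk

/-! ### Schönhage's reduction to shorter products. -/

section schoenhage

variable {V : Type*} [CommRing V] {Ω : Set V} {p : ℕ} {h : V}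

/-- Multiplication modulo `phi` over `V[X] / phi V p (p ^ K)`, in terms of operations in `V`. -/
theorem exists_coeffs_mul_mod (hp : p = 2 ∨ p = 3) (hh : h * p = 1) (hΩ : h ∈ Ω) {K k W : ℕ}
    {ψ : V[X]} (hψ : ψ = phi V p (p ^ K)) (hk : k ≤ K) (hW : MulMod Ω 1 1 ψ (p ^ K * p) W)
    {A : Set V} (h0 : 0 ∈ A) {a b : (AdjoinRoot ψ)[X]} (ha : a.degree < (p ^ k * p : ℕ))
    (hb : b.degree < (p ^ k * p : ℕ))
    (haA : cf a ⊆ Available ψ (p ^ K * p) A) (hbA : cf b ⊆ Available ψ (p ^ K * p) A) :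
    ∃ B, SLP Ω 1 1 A ((p - 1) * (p ^ k * W + 7 * p * k * p ^ k * (p ^ K * p)) +
        7 * p * p * p ^ k * (p ^ K * p) + p * (p ^ k * (p ^ K * p))) B ∧
      cf ((a * b) %ₘ phi _ p (p ^ k)) ⊆ Available ψ (p ^ K * p) (A ∪ B) := by
  have hpp : p.Prime := by rcases hp with rfl | rfl <;> norm_num
  have hp0 : 0 < p := hpp.pos
  set n := p ^ K * p with hn
  have hn0 : 0 < n := by positivity
  have hψn : ψ ∣ X ^ n - 1 := hψ ▸ phi_dvd _
  have hXn : AdjoinRoot.mk ψ X ^ n = 1 := by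
    have := AdjoinRoot.mk_eq_zero.mpr hψn
    rwa [map_sub, map_pow, map_one, sub_eq_zero] at this
  obtain ⟨n', hn'⟩ := Nat.exists_eq_succ_of_ne_zero hn0.ne'
  set ω : (AdjoinRoot ψ)ˣ := ⟨AdjoinRoot.mk ψ X, AdjoinRoot.mk ψ X ^ n',
    by rw [← pow_succ', ← Nat.succ_eq_add_one, ← hn', hXn],
    by rw [← pow_succ, ← Nat.succ_eq_add_one, ← hn', hXn]⟩ with hω
  have hωn : ω ^ n = 1 := by
    ext
    exact hXn
  set ΩD : Set (AdjoinRoot ψ) := {u | (∃ e : ℕ, u = AdjoinRoot.mk ψ X ^ e) ∨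
    u = AdjoinRoot.mk ψ (C h)} with hΩD
  have hωΩ : ∀ e : ℤ, ((ω ^ e : (AdjoinRoot ψ)ˣ) : AdjoinRoot ψ) ∈ ΩD := by
    intro e
    refine .inl ⟨(e % n).toNat, ?_⟩
    rw [zpow_eq_zpow_emod' e hωn]
    have : (e % n) = ((e % n).toNat : ℤ) := (Int.toNat_of_nonneg
      (Int.emod_nonneg _ (by omega))).symm
    rw [this, zpow_natCast]
    rfl
  have hζ : (ω ^ (p ^ K)) ^ p = 1 := by rw [← pow_mul, ← hn, hωn]
  -- In `V[X] / ψ` the relation `ψ = 0` is exactly the vanishing geometric sum for `ζ = X^(p^K)`.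
  have horth : RootOrth p (ω ^ (p ^ K)) := by
    refine RootOrth.of_geom_sum hp ?_
    have : AdjoinRoot.mk ψ (phi V p (p ^ K)) = 0 := by rw [← hψ, AdjoinRoot.mk_self]
    rw [phi, map_sum] at this
    rw [← this]
    refine Finset.sum_congr rfl fun i _ => ?_
    rw [map_pow, pow_mul]
    rfl
  have hlift : ∀ u ∈ ΩD, ∀ A : Set V, 0 ∈ A → ∀ P : V[X], P.degree < n → cf P ⊆ A →
      ∃ Q : V[X], Q.degree < n ∧ AdjoinRoot.mk ψ Q = u * AdjoinRoot.mk ψ P ∧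
        SLP Ω 1 1 A n (cf Q) := by
    rintro u (⟨e, rfl⟩ | rfl) A h0 P hP hPA
    · obtain ⟨Q, hQ, hQA, he⟩ := exists_rotate hn0 hψn h0 hP hPA e
      exact ⟨Q, hQ, he, .done hQA⟩
    · exact ⟨C h * P, degree_C_mul_lt _ hP, map_mul _ _ _,
        by simpa using SLP.poly_smul (Ω := Ω) (l := 1) (w := 1) h0 hP hΩ hPA⟩
  have h0' : (0 : AdjoinRoot ψ) ∈ Available ψ n A :=
    ⟨0, by rw [degree_zero]; exact WithBot.bot_lt_coe n, cf_zero_subset h0, map_zero _⟩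
  obtain ⟨c, hc, hd, hs⟩ := mulMod_phi (l := n) (w := W) hp0
    (h := AdjoinRoot.mk ψ (C h)) (Ω := ΩD)
    (by rw [← map_natCast (AdjoinRoot.mk ψ), ← map_mul, ← C_eq_natCast, ← C_mul, hh, C_1, map_one])
    (.inr rfl) ω hωΩ K hζ horth k hk (Available ψ n A) h0' a b ha hb haA hbA
  have hs2 := hs.trans (SLP.modByMonic_phi hpp (pow_pos hp0 k) hc (.inl h0')
    Set.subset_union_right)
  rw [modByMonic_eq_of_dvd_sub (phi_monic hpp (pow_pos hp0 k)) hd]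
  exact SLP.lift hW hlift hs2 A h0 le_rfl

/-- One level of Schönhage's multiplication algorithm. -/
theorem mulMod_step (hp : p = 2 ∨ p = 3) (hh : h * p = 1) (hΩ : h ∈ Ω) {K k m W : ℕ}
    (hk : k ≤ K) (hm : 0 < m) (hmK : 2 * m ≤ (p - 1) * p ^ K)
    (hW : MulMod Ω 1 1 (phi V p (p ^ K)) (p ^ K * p) W) :
    MulMod Ω 1 1 (phi V p (p ^ k * m)) (p ^ k * m * p)
      ((p - 1) * (p ^ k * W + 7 * p * k * p ^ k * (p ^ K * p)) +
        7 * p * p * p ^ k * (p ^ K * p) + p * (p ^ k * (p ^ K * p)) +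
        (p - 1) * p ^ k * (p * (p ^ K * 1)) + p ^ k * m * p * 1) := by
  intro A h0 a b ha hb haA hbA
  rcases subsingleton_or_nontrivial V with hV | hV
  · refine ⟨0, ?_, ?_, .done (cf_zero_subset h0)⟩
    · rw [degree_zero]; exact WithBot.bot_lt_coe _
    · rw [Subsingleton.elim (a * b - 0) 0]; exact dvd_zero _
  have hpp : p.Prime := by rcases hp with rfl | rfl <;> norm_num
  have hp0 : 0 < p := hpp.pos
  set ψ := phi V p (p ^ K) with hψ
  have hψm : ψ.Monic := phi_monic hpp (pow_pos hp0 K)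
  set t := p ^ k with ht
  have ht0 : 0 < t := pow_pos hp0 k
  have hmn : m ≤ p ^ K * p := by
    calc m ≤ 2 * m := by omega
      _ ≤ (p - 1) * p ^ K := hmK
      _ ≤ p * p ^ K := Nat.mul_le_mul_right _ (Nat.sub_le _ _)
      _ = _ := mul_comm _ _
  have hsz : m * (t * p) = t * m * p := by ring
  -- the chunks of a polynomial, reduced modulo `ψ`
  have hchdeg : ∀ a : V[X], ((chunk m (t * p) a).map (AdjoinRoot.mk ψ)).degree < (t * p : ℕ) := by
    intro a
    rw [degree_lt_iff_coeff_zero]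
    intro i hi
    rw [coeff_map, coeff_chunk, if_neg (by omega), map_zero]
  have hchA : ∀ a : V[X], cf a ⊆ A →
      cf ((chunk m (t * p) a).map (AdjoinRoot.mk ψ)) ⊆ Available ψ (p ^ K * p) A := by
    intro a ha
    rw [cf_subset_iff]
    intro i
    refine ⟨(chunk m (t * p) a).coeff i, ?_, ?_, (coeff_map _ _).symm⟩
    · exact (degree_coeff_chunk _ _ _ _).trans_le (by exact_mod_cast hmn)
    · rw [coeff_chunk]
      split_ifs
      exacts [cf_blk h0 ha _ _, cf_zero_subset h0]
  obtain ⟨B, hB, hcf⟩ := exists_coeffs_mul_mod hp hh hΩ hψ hk hW h0 (hchdeg a) (hchdeg b)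
    (hchA a haA) (hchA b hbA)
  have hΦm : (phi V[X] p t).Monic := phi_monic hpp ht0
  set c := (chunk m (t * p) a * chunk m (t * p) b) %ₘ phi V[X] p t with hc
  have hcmap : (chunk m (t * p) a).map (AdjoinRoot.mk ψ) * (chunk m (t * p) b).map
      (AdjoinRoot.mk ψ) %ₘ phi _ p t = c.map (AdjoinRoot.mk ψ) := by
    rw [hc, map_modByMonic _ hΦm, map_phi, Polynomial.map_mul]
  have hcdeg : ∀ j, (c.coeff j).degree < (2 * m : ℕ) := by
    intro j
    rw [two_mul, hc, ← map_phi (C : V →+* V[X])]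
    exact degree_coeff_modByMonic_lt (phi_monic hpp ht0) (degree_coeff_mul_lt
      (degree_coeff_chunk _ _ _) (degree_coeff_chunk _ _ _)) j
  have hcdeg' : c.degree < ((p - 1) * t : ℕ) := by
    rw [← degree_phi (R := V[X]) hpp ht0]
    exact degree_modByMonic_lt _ hΦm
  rw [hcmap, cf_subset_iff] at hcf
  choose Q hQdeg hQA hQ using hcf
  -- The coefficients of `c` have degree `< 2m ≤ deg ψ`, so they are recovered from their classes
  -- modulo `ψ`.
  have hQc : ∀ j, Q j %ₘ ψ = c.coeff j := by
    intro j
    have h1 := hQ j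
    rw [coeff_map, AdjoinRoot.mk_eq_mk] at h1
    rw [modByMonic_eq_of_dvd_sub hψm h1, modByMonic_eq_self_iff hψm, degree_phi hpp (pow_pos hp0 K)]
    exact (hcdeg j).trans_le (by exact_mod_cast hmK)
  have hs2 := SLP.biUnion (Ω := Ω) (l := 1) (w := 1) (A := A ∪ B) (fun j => cf (c.coeff j))
    ((p - 1) * t) (fun j _ => by
      rw [← hQc]
      exact SLP.modByMonic_phi hpp (pow_pos hp0 K) (hQdeg j) (.inl h0) (hQA j))
  have hs := (hB.seq hs2)
  set D := B ∪ ⋃ j < (p - 1) * t, cf (c.coeff j) with hD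
  have hcA : ∀ j, cf (c.coeff j) ⊆ A ∪ D := by
    intro j
    by_cases hj : j < (p - 1) * t
    · exact fun x hx => .inr (.inr (Set.mem_biUnion (x := j) hj hx))
    · rw [(degree_lt_iff_coeff_zero _ _).mp hcdeg' j (by omega)]
      exact cf_zero_subset (.inl h0)
  set E := c.eval (X ^ m) with hE
  have hEsum : E = ∑ j ∈ Finset.range (2 * ((p - 1) * t)), X ^ (m * j) * c.coeff j := by
    have hnd : c.natDegree < 2 * ((p - 1) * t) := by
      have hpos : 0 < (p - 1) * t := Nat.mul_pos (by have := hpp.two_le; omega) ht0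
      rcases eq_or_ne c 0 with h | h
      · rw [h, natDegree_zero]; omega
      · rw [← natDegree_lt_iff_degree_lt h] at hcdeg'
        omega
    rw [hE, eval_eq_sum_range' hnd]
    exact Finset.sum_congr rfl fun j _ => by rw [pow_mul, mul_comm]
  have hEdeg : E.degree < (t * m * p : ℕ) := by
    rw [hEsum]
    refine degree_sum_lt _ _ fun j _ => ?_
    by_cases hj : j < (p - 1) * t
    · have h1 : (X ^ (m * j) : V[X]).degree < (m * j + 1 : ℕ) :=
        (degree_X_pow_le _).trans_lt (by exact_mod_cast Nat.lt_succ_self _)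
      have h2 : m * (j + 2) ≤ t * m * p := by
        rw [← hsz]
        refine Nat.mul_le_mul_left _ ?_
        obtain ⟨q, rfl⟩ := Nat.exists_eq_succ_of_ne_zero hp0.ne'
        have : t * q.succ = q.succ.pred * t + t := by rw [Nat.pred_succ, Nat.mul_succ, mul_comm]
        rw [Nat.succ_sub_one] at hj
        rw [Nat.pred_succ] at this
        omega
      rw [degree_lt_iff_coeff_zero]
      intro i hi
      rw [coeff_X_pow_mul']
      split_ifs with h3
      · refine (degree_lt_iff_coeff_zero _ _).mp (hcdeg j) _ ?_
        have h4 : m * (j + 2) = m * j + 2 * m := by ring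
        omega
      · rfl
    · rw [(degree_lt_iff_coeff_zero _ _).mp hcdeg' j (by omega), mul_zero, degree_zero]
      exact WithBot.bot_lt_coe _
  refine ⟨E, hEdeg, ?_, ?_⟩
  · have h1 := modByMonic_add_div (chunk m (t * p) a * chunk m (t * p) b) (phi V[X] p t)
    have h2 := congrArg (eval (X ^ m)) h1
    rw [eval_add, eval_mul, eval_mul, eval_chunk hm (by rwa [hsz]),
      eval_chunk hm (by rwa [hsz])] at h2
    have h3 : (phi V[X] p t).eval (X ^ m) = phi V p (t * m) := by
      simp only [phi, eval_finsetSum, eval_pow, eval_X, ← pow_mul]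
      exact Finset.sum_congr rfl fun i _ => by congr 1; ring
    rw [h3] at h2
    refine ⟨((chunk m (t * p) a * chunk m (t * p) b) /ₘ (phi V[X] p t)).eval (X ^ m), ?_⟩
    rw [hE, hc, ← h2]
    ring
  · refine hs.trans ?_
    have := SLP.overlap (Ω := Ω) (l := 1) (w := 1) (A := A ∪ D) (.inl h0) hm ((p - 1) * t)
      (fun j => c.coeff j) hcdeg hcA (n := t * m * p) (by rw [← hEsum]; exact hEdeg)
    rwa [← hEsum] at this

end schoenhage

/-! ### Cost of fast multiplication. -/

section cost

variable {V : Type*} [CommRing V] {Ω : Set V} {p : ℕ} {h : V}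

theorem X_pow_sub_one_dvd_X_pow_sub (n k : ℕ) : (X ^ n - 1 : V[X]) ∣ X ^ k - X ^ (k % n) := by
  conv_rhs => rw [← Nat.div_add_mod k n, pow_add, pow_mul]
  rw [Nat.mul_add_mod, Nat.mod_mod, ← sub_one_mul]
  exact (sub_one_dvd_pow_sub_one _ _).mul_right _
where
  sub_one_dvd_pow_sub_one (x : V[X]) (m : ℕ) : x - 1 ∣ x ^ m - 1 := by
    simpa using sub_dvd_pow_sub_pow x 1 m

/-- Multiplication modulo `phi` by the schoolbook method. -/
theorem mulMod_naive {t : ℕ} (htp : 0 < t * p) :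
    MulMod Ω 1 1 (phi V p t) (t * p) (2 * (t * p) ^ 3) := by
  intro A h0 a b ha hb haA hbA
  set n := t * p with hn
  set s := Finset.range n ×ˢ Finset.range n with hs
  have hab : ∀ a : V[X], a.degree < n → a = ∑ i ∈ Finset.range n, C (a.coeff i) * X ^ i := by
    intro a ha
    rcases eq_or_ne a 0 with h | h
    · simp [h]
    · exact a.as_sum_range_C_mul_X_pow' ((natDegree_lt_iff_degree_lt h).mpr ha)
  refine ⟨∑ x ∈ s, C (a.coeff x.1 * b.coeff x.2) * X ^ ((x.1 + x.2) % n), ?_, ?_, ?_⟩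
  · refine degree_sum_lt _ _ fun x _ => degree_C_mul_lt _ ?_
    exact (degree_X_pow_le _).trans_lt (by exact_mod_cast Nat.mod_lt _ htp)
  · refine (phi_dvd t).trans ?_
    have hmul : a * b =
        ∑ x ∈ s, C (a.coeff x.1) * X ^ x.1 * (C (b.coeff x.2) * X ^ x.2) := by
      conv_lhs => rw [hab a ha, hab b hb, Finset.sum_mul_sum, ← Finset.sum_product']
    rw [hmul, ← Finset.sum_sub_distrib]
    refine Finset.dvd_sum fun x _ => ?_
    have : C (a.coeff x.1) * X ^ x.1 * (C (b.coeff x.2) * X ^ x.2) -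
        C (a.coeff x.1 * b.coeff x.2) * X ^ ((x.1 + x.2) % n) =
        C (a.coeff x.1 * b.coeff x.2) * (X ^ (x.1 + x.2) - X ^ ((x.1 + x.2) % n)) := by
      rw [C_mul, pow_add]; ring
    rw [this]
    exact (X_pow_sub_one_dvd_X_pow_sub n _).mul_left _
  · have h1 : ∀ j < n, SLP Ω 1 1 A (n ^ 2 * (1 + 1))
        {(∑ x ∈ s, C (a.coeff x.1 * b.coeff x.2) * X ^ ((x.1 + x.2) % n)).coeff j} := by
      intro j _
      have h2 : (∑ x ∈ s, C (a.coeff x.1 * b.coeff x.2) * X ^ ((x.1 + x.2) % n)).coeff j =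
          ∑ x ∈ s with j = (x.1 + x.2) % n, a.coeff x.1 * b.coeff x.2 := by
        rw [finsetSum_coeff, Finset.sum_filter]
        refine Finset.sum_congr rfl fun x _ => ?_
        rw [coeff_C_mul_X_pow]
      rw [h2]
      refine (SLP.sum _ _ h0 fun x _ => SLP.singleton_mul (haA ⟨_, rfl⟩) (hbA ⟨_, rfl⟩)).mono
        le_rfl le_rfl (Nat.mul_le_mul_right _ ((Finset.card_filter_le _ _).trans ?_))
      rw [hs, Finset.card_product, Finset.card_range, sq]
    refine (SLP.poly h0 ?_ h1).mono le_rfl le_rfl (le_of_eq (by ring))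
    refine degree_sum_lt _ _ fun x _ => degree_C_mul_lt _ ?_
    exact (degree_X_pow_le _).trans_lt (by exact_mod_cast Nat.mod_lt _ htp)

/-- The cost of a multiplication modulo `phi V p (p ^ (j + 3))`, divided by `p ^ (j + 3)`. -/
def growth (j : ℕ) : ℕ := 40032 * (j * (1 + Nat.log 2 j)) + 39366

theorem growth_mono : Monotone growth := fun a b hab => by
  unfold growth
  have := Nat.log_mono_right (b := 2) hab
  gcongr

/-- The recursion `g(j) = 2 g(j/2) + O(j)`, with solution `O(j log j)`. The constant term `39366 = 2
* 81^3 / 27` of `growth` is the schoolbook cost for `p = 3`, `j = 0`; the factor `40032 = 39366 +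
666` gives equality at `j = 1`. -/
theorem growth_step {j : ℕ} (hj : 0 < j) : 2 * growth (j / 2) + 333 * (j + 1) ≤ growth j := by
  unfold growth
  rcases Nat.lt_or_ge j 2 with h | h
  · obtain rfl : j = 1 := by omega
    norm_num
  · have h1 : Nat.log 2 j = Nat.log 2 (j / 2) + 1 := by
      rw [Nat.log_div_base, Nat.sub_add_cancel]
      exact Nat.log_pos (by norm_num) h
    rw [h1]
    have h2 : 2 * (j / 2) ≤ j := Nat.mul_div_le j 2
    have h3 := Nat.mul_le_mul_right (1 + Nat.log 2 (j / 2)) h2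
    have h4 : j * (1 + (Nat.log 2 (j / 2) + 1)) = j * (1 + Nat.log 2 (j / 2)) + j := by ring
    have h5 : 2 * (j / 2) * (1 + Nat.log 2 (j / 2)) = 2 * ((j / 2) * (1 + Nat.log 2 (j / 2))) := by
      ring
    omega

/-- The leading factor must be `2` for both radices: it is `p^e (p - 1)`, with `p^e = 2` from the
padding for `p = 2`, and `p - 1 = 2` from omitting the root `1` for `p = 3`. Using all `p` roots
would give a factor `3` or `4` and a superlogarithmic loss. -/
theorem step_cost_le {e k K j W : ℕ} (hpe : p = 2 ∧ e = 1 ∨ p = 3 ∧ e = 0)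
    (hkK : k + K = j + 3 + e) (hk : k ≤ j + 1) (hW : W = p ^ K * growth (j / 2)) (hj : 0 < j) :
    (p - 1) * (p ^ k * W + 7 * p * k * p ^ k * (p ^ K * p)) + 7 * p * p * p ^ k * (p ^ K * p) +
      p * (p ^ k * (p ^ K * p)) + (p - 1) * p ^ k * (p * (p ^ K * 1)) + p ^ (j + 3) * p * 1 ≤
    p ^ (j + 3) * growth j := by
  have h1 : p ^ k * p ^ K = p ^ e * p ^ (j + 3) := by rw [← pow_add, ← pow_add, hkK, add_comm]
  have h2 := growth_step hj
  set Z := p ^ (j + 3) with hZ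
  have h3 : (p - 1) * (p ^ k * W + 7 * p * k * p ^ k * (p ^ K * p)) +
      7 * p * p * p ^ k * (p ^ K * p) +
      p * (p ^ k * (p ^ K * p)) + (p - 1) * p ^ k * (p * (p ^ K * 1)) + Z * p * 1 =
      (p ^ k * p ^ K) * ((p - 1) * (growth (j / 2) + 7 * p * k * p) + 7 * p * p * p +
        p * p + (p - 1) * p) + Z * p := by
    rw [hW]; ring
  rw [h3, h1]
  refine le_trans ?_ (Nat.mul_le_mul_left Z h2)
  rcases hpe with ⟨rfl, rfl⟩ | ⟨rfl, rfl⟩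
  · norm_num
    calc _ = Z * (2 * growth (j / 2) + 56 * k + 126) := by ring
      _ ≤ _ := Nat.mul_le_mul_left _ (by omega)
  · norm_num
    calc _ = Z * (2 * growth (j / 2) + 126 * k + 207) := by ring
      _ ≤ _ := Nat.mul_le_mul_left _ (by omega)

theorem mulMod_phi_pow (hp : p = 2 ∨ p = 3) (hh : h * p = 1) (hΩ : h ∈ Ω) (j : ℕ) :
    MulMod Ω 1 1 (phi V p (p ^ (j + 3))) (p ^ (j + 3) * p) (p ^ (j + 3) * growth j) := by
  have hp0 : 0 < p := by omega
  induction j using Nat.strong_induction_on with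
  | _ j ih =>
    rcases Nat.eq_zero_or_pos j with rfl | hj
    · intro A h0 a b ha hb haA hbA
      obtain ⟨c, hc, hd, hs⟩ := mulMod_naive (Ω := Ω) (V := V) (p := p) (t := p ^ (0 + 3))
        (by positivity) A h0 a b ha hb haA hbA
      refine ⟨c, hc, hd, hs.mono le_rfl le_rfl ?_⟩
      rcases hp with rfl | rfl <;> norm_num [growth]
    · obtain ⟨e, hpe⟩ : ∃ e, p = 2 ∧ e = 1 ∨ p = 3 ∧ e = 0 := by
        rcases hp with rfl | rfl
        exacts [⟨1, by simp⟩, ⟨0, by simp⟩]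
      have he : e ≤ 1 := by omega
      have hdiv : j / 2 < j := Nat.div_lt_self hj (by norm_num)
      -- About square-root splitting: `p^k m = p^(j+3)` with `k` and `K` near `j/2`. The shift `e =
      -- 1` for `p = 2` halves the chunks, to satisfy `2m ≤ (p - 1) p^K`; the offset `3` guarantees
      -- `k ≤ K`.
      have h1 := mulMod_step hp hh hΩ (K := j / 2 + 3) (k := j - j / 2 + e)
        (m := p ^ (j / 2 + 3 - e)) (by omega) (by positivity) (by
          rcases hpe with ⟨rfl, rfl⟩ | ⟨rfl, rfl⟩
          · rw [← pow_succ']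
            norm_num
          · norm_num) (ih (j / 2) hdiv)
      have h2 : p ^ (j - j / 2 + e) * p ^ (j / 2 + 3 - e) = p ^ (j + 3) := by
        rw [← pow_add]; congr 1; omega
      rw [h2] at h1
      intro A h0 a b ha hb haA hbA
      obtain ⟨c, hc, hd, hs⟩ := h1 A h0 a b ha hb haA hbA
      exact ⟨c, hc, hd, hs.mono le_rfl le_rfl
        (step_cost_le hpe (by omega) (by omega) rfl hj)⟩

/-- Products of polynomials of degree `< 2 ^ i` can be computed at cost `M i`. -/
def FastMul (Ω : Set V) (M : ℕ → ℕ) : Prop :=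
  ∀ (i : ℕ) (A : Set V), 0 ∈ A → ∀ P Q : V[X], P.degree < (2 ^ i : ℕ) → Q.degree < (2 ^ i : ℕ) →
    cf P ⊆ A → cf Q ⊆ A → SLP Ω 1 1 A (M i) (cf (P * Q))

/-- The cost of Schönhage's algorithm for polynomials of degree `< 2 ^ i`. -/
def mulCost (i : ℕ) : ℕ := 2 ^ i * (81 * growth i + 243)

/-- The modulus is taken of degree at least `2 * 2^i`, so the product is its own residue. Rounding
up to a power of `p` and the offset `3` cost at most the factor `p^4 ≤ 81`. -/
theorem fastMul (hp : p = 2 ∨ p = 3) (hh : h * p = 1) (hΩ : h ∈ Ω) : FastMul Ω mulCost := by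
  intro i A h0 P Q hP hQ hPA hQA
  rcases subsingleton_or_nontrivial V with hV | hV
  · exact .done fun x _ => by rwa [Subsingleton.elim x 0]
  have hpp : p.Prime := by rcases hp with rfl | rfl <;> norm_num
  set j := Nat.clog p (2 ^ i) with hj
  have h1 : 2 ^ i ≤ p ^ j := Nat.le_pow_clog hpp.one_lt _
  have h2 : j ≤ i := by
    rw [hj, Nat.clog_le_iff_le_pow hpp.one_lt]
    exact Nat.pow_le_pow_left hpp.two_le _
  have h3 : p ^ j ≤ p * 2 ^ i := by
    rcases Nat.eq_zero_or_pos i with rfl | hi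
    · simp [hj, hpp.one_lt.le]
    · have := Nat.pow_pred_clog_lt_self hpp.one_lt (Nat.one_lt_two_pow hi.ne')
      have hj0 : 0 < j := Nat.clog_pos hpp.one_lt (Nat.one_lt_two_pow hi.ne')
      obtain ⟨j', hj'⟩ := Nat.exists_eq_succ_of_ne_zero hj0.ne'
      rw [← hj, hj', Nat.pred_succ] at this
      rw [hj', pow_succ']
      exact Nat.mul_le_mul_left _ this.le
  have h4 : p ^ (j + 3) ≤ 81 * 2 ^ i := by
    rw [pow_add]
    refine (Nat.mul_le_mul_right _ h3).trans ?_
    rcases hp with rfl | rfl <;> omega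
  have h5 : 2 * 2 ^ i ≤ (p - 1) * p ^ (j + 3) := by
    refine (Nat.mul_le_mul_left 2 h1).trans ?_
    rw [pow_add]
    rcases hp with rfl | rfl <;> omega
  have h6 : 2 * 2 ^ i ≤ p ^ (j + 3) * p := h5.trans (by
    rw [mul_comm]; exact Nat.mul_le_mul_left _ (Nat.sub_le _ _))
  obtain ⟨c, hc, hd, hs⟩ := mulMod_phi_pow hp hh hΩ j A h0 P Q
    (hP.trans_le (by exact_mod_cast (by omega : 2 ^ i ≤ p ^ (j + 3) * p)))
    (hQ.trans_le (by exact_mod_cast (by omega : 2 ^ i ≤ p ^ (j + 3) * p))) hPA hQA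
  have hm := phi_monic (R := V) hpp (t := p ^ (j + 3)) (pow_pos hpp.pos _)
  have h7 : c %ₘ phi V p (p ^ (j + 3)) = P * Q := by
    rw [← modByMonic_eq_of_dvd_sub hm hd, modByMonic_eq_self_iff hm,
      degree_phi hpp (pow_pos hpp.pos _)]
    refine (degree_mul_lt_add hP hQ).trans_le ?_
    exact_mod_cast (by omega : 2 ^ i + 2 ^ i ≤ (p - 1) * p ^ (j + 3))
  have := hs.trans (SLP.modByMonic_phi hpp (pow_pos hpp.pos _) hc (.inl h0)
    Set.subset_union_right)
  rw [h7] at this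
  refine this.mono le_rfl le_rfl ?_
  have h8 := growth_mono h2
  calc p ^ (j + 3) * growth j + p * (p ^ (j + 3) * 1)
      ≤ (81 * 2 ^ i) * growth i + 3 * (81 * 2 ^ i) := by
        rw [mul_one]
        gcongr
        omega
    _ = mulCost i := by unfold mulCost; ring

end cost

/-! ### Computation trees on families of instances. -/

section achieves

variable {I : Type*} {F : I → Type v} [∀ ι, Field (F ι)] {k : ℕ}

/-- The family `F` of fields describes all instances of a problem; a value that is available to an
algorithm is a function of the instance. `Achieves S A G c` says that from any memory
that contains the values in `A`, a tree of cost at most `c` returns `G` for all instances in `S`. -/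
def Achieves (S : Set I) (A : Set (∀ ι, F ι)) (G : ∀ ι, Fin k → F ι) (c : ℕ) : Prop :=
  ∀ (n : ℕ) (x : Fin n → ∀ ι, F ι), A ⊆ Set.range x →
    ∃ T : CompTree k n, T.cost ≤ c ∧ ∀ ι ∈ S, T.run (fun j => x j ι) = some (G ι)

namespace Achieves

variable {S : Set I} {A : Set (∀ ι, F ι)} {G : ∀ ι, Fin k → F ι} {c : ℕ}

theorem output (h : ∀ l, ∃ z ∈ A, ∀ ι ∈ S, z ι = G ι l) : Achieves S A G 0 := by
  intro n x hx
  choose z hz hzG using h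
  choose r hr using fun l => hx (hz l)
  refine ⟨.output r, le_rfl, fun ι hι => ?_⟩
  rw [CompTree.run]
  congr 1
  funext l
  rw [hr, hzG l ι hι]

theorem mono {S' : Set I} {A' : Set (∀ ι, F ι)} {c' : ℕ} (h : Achieves S A G c) (hS : S' ⊆ S)
    (hA : A ⊆ A') (hc : c ≤ c') : Achieves S' A' G c' := by
  intro n x hx
  obtain ⟨T, hT, hr⟩ := h n x (hA.trans hx)
  exact ⟨T, hT.trans hc, fun ι hι => hr ι (hS hι)⟩

omit [∀ ι, Field (F ι)] in
theorem snoc_apply {n : ℕ} (x : Fin n → ∀ ι, F ι) (y : ∀ ι, F ι) (ι : I) :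
    (fun j => (Fin.snoc x y : Fin (n + 1) → ∀ ι, F ι) j ι) =
      (Fin.snoc (fun j => x j ι) (y ι) : Fin (n + 1) → F ι) := by
  funext j
  refine Fin.lastCases ?_ (fun j => ?_) j
  · simp only [Fin.snoc_last]
  · simp only [Fin.snoc_castSucc]

omit [∀ ι, Field (F ι)] in
theorem insert_subset_range_snoc {n : ℕ} {x : Fin n → ∀ ι, F ι} (hx : A ⊆ Set.range x)
    (y : ∀ ι, F ι) :
    insert y A ⊆ Set.range (Fin.snoc x y : Fin (n + 1) → ∀ ι, F ι) := by
  refine Set.insert_subset ⟨Fin.last n, by simp only [Fin.snoc_last]⟩ fun z hz => ?_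
  obtain ⟨j, rfl⟩ := hx hz
  exact ⟨j.castSucc, by simp only [Fin.snoc_castSucc]⟩

theorem const (one : Bool) (h : Achieves S (insert (if one then 1 else 0) A) G c) :
    Achieves S A G (c + 1) := by
  intro n x hx
  obtain ⟨T, hT, hr⟩ := h (n + 1) _ (insert_subset_range_snoc hx _)
  refine ⟨.const one T, Nat.succ_le_succ hT, fun ι hι => ?_⟩
  rw [CompTree.run, ← hr ι hι, snoc_apply]
  cases one <;> rfl

theorem arith (o : ArithOp) {a b y : ∀ ι, F ι} (ha : a ∈ A) (hb : b ∈ A)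
    (hy : ∀ ι ∈ S, o.apply (a ι) (b ι) = some (y ι)) (h : Achieves S (insert y A) G c) :
    Achieves S A G (c + 1) := by
  intro n x hx
  obtain ⟨T, hT, hr⟩ := h (n + 1) _ (insert_subset_range_snoc hx y)
  obtain ⟨i, rfl⟩ := hx ha
  obtain ⟨j, rfl⟩ := hx hb
  refine ⟨.arith o i j T, Nat.succ_le_succ hT, fun ι hι => ?_⟩
  rw [CompTree.run, hy ι hι, ← hr ι hι, snoc_apply]
  rfl

theorem test {a : ∀ ι, F ι} (ha : a ∈ A) (h0 : Achieves {ι ∈ S | a ι = 0} A G c)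
    (h1 : Achieves {ι ∈ S | a ι ≠ 0} A G c) : Achieves S A G (c + 1) := by
  intro n x hx
  obtain ⟨T0, hT0, hr0⟩ := h0 n x hx
  obtain ⟨T1, hT1, hr1⟩ := h1 n x hx
  obtain ⟨i, rfl⟩ := hx ha
  refine ⟨.test i T0 T1, Nat.succ_le_succ (max_le hT0 hT1), fun ι hι => ?_⟩
  rw [CompTree.run]
  split_ifs with h
  · exact hr0 ι ⟨hι, h⟩
  · exact hr1 ι ⟨hι, h⟩

theorem div {a b : ∀ ι, F ι} (ha : a ∈ A) (hb : b ∈ A) (hb0 : ∀ ι ∈ S, b ι ≠ 0)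
    (h : Achieves S (insert (a / b) A) G c) : Achieves S A G (c + 1) :=
  arith .div ha hb (fun ι hι => by rw [ArithOp.apply, if_neg (hb0 ι hι)]; rfl) h

/-- Ring operations in the product of the fields are pointwise, so one branch-free piece of a tree
serves all instances. -/
theorem slp {Ω A B : Set (∀ ι, F ι)} {c d : ℕ} (hs : SLP Ω 1 1 A c B) (hΩ : Ω ⊆ A)
    (h : Achieves S (A ∪ B) G d) : Achieves S A G (c + d) := by
  induction hs with
  | done hB =>
    rw [Set.union_eq_self_of_subset_right hB] at h
    exact h.mono le_rfl le_rfl (Nat.le_add_left _ _)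
  | add hx hy _ ih =>
    rw [add_right_comm]
    exact arith .add hx hy (fun _ _ => rfl) (ih (hΩ.trans (Set.subset_insert _ _))
      (h.mono le_rfl (Set.union_subset_union_left _ (Set.subset_insert _ _)) le_rfl))
  | sub hx hy _ ih =>
    rw [add_right_comm]
    exact arith .sub hx hy (fun _ _ => rfl) (ih (hΩ.trans (Set.subset_insert _ _))
      (h.mono le_rfl (Set.union_subset_union_left _ (Set.subset_insert _ _)) le_rfl))
  | smul hx hy _ ih =>
    rw [add_right_comm]
    exact arith .mul (hΩ hx) hy (fun _ _ => rfl) (ih (hΩ.trans (Set.subset_insert _ _))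
      (h.mono le_rfl (Set.union_subset_union_left _ (Set.subset_insert _ _)) le_rfl))
  | mul hx hy _ ih =>
    rw [add_right_comm]
    exact arith .mul hx hy (fun _ _ => rfl) (ih (hΩ.trans (Set.subset_insert _ _))
      (h.mono le_rfl (Set.union_subset_union_left _ (Set.subset_insert _ _)) le_rfl))

/-- Restriction to a subtype of instances. -/
theorem of_subtype (h : Achieves (I := S) (F := fun ι => F ι) Set.univ
    ((fun z (ι : S) => z ι) '' A) (fun ι => G ι) c) : Achieves S A G c := by
  intro n x hx
  obtain ⟨T, hT, hr⟩ := h n (fun j ι => x j ι) (by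
    rintro _ ⟨z, hz, rfl⟩
    obtain ⟨j, rfl⟩ := hx hz
    exact ⟨j, rfl⟩)
  exact ⟨T, hT, fun ι hι => hr ⟨ι, hι⟩ trivial⟩

end Achieves

end achieves

/-! ### Division steps and their transition matrices. -/

section divstep

variable {K : Type*} [Field K]

open Classical in
/-- The division step of Bernstein and Yang. -/
noncomputable def divstep (s : ℤ × (Fin 2 → K[X])) : ℤ × (Fin 2 → K[X]) :=
  if 0 < s.1 ∧ (s.2 1).coeff 0 ≠ 0 then
    (1 - s.1, ![s.2 1,
      divX (C ((s.2 1).coeff 0) * s.2 0 - C ((s.2 0).coeff 0) * s.2 1)])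
  else
    (1 + s.1, ![s.2 0,
      divX (C ((s.2 0).coeff 0) * s.2 1 - C ((s.2 1).coeff 0) * s.2 0)])

/-- For all vectors that agree with `v₀` modulo `X ^ n`, the first `n` division steps lead from `δ`
to `δ'` and, up to the factor `X ^ n`, multiply the vector by the matrix `Q`. -/
def IsTransition (n : ℕ) (δ : ℤ) (v₀ : Fin 2 → K[X]) (δ' : ℤ) (Q : Matrix (Fin 2) (Fin 2) K[X]) :
    Prop :=
  ∀ v : Fin 2 → K[X], (∀ i, X ^ n ∣ v i - v₀ i) →
    (divstep^[n] (δ, v)).1 = δ' ∧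
      ∀ i, X ^ n * (divstep^[n] (δ, v)).2 i = Q i 0 * v 0 + Q i 1 * v 1

theorem X_mul_divX_sub (a b : K) (f g : K[X]) (h : a * f.coeff 0 = b * g.coeff 0) :
    X * divX (C a * f - C b * g) = C a * f - C b * g := by
  have h1 := divX_mul_X_add (C a * f - C b * g)
  rw [coeff_sub, coeff_C_mul, coeff_C_mul, h, sub_self, C_0, add_zero] at h1
  rw [mul_comm, h1]

theorem coeff_zero_eq_of_dvd {f g : K[X]} (h : X ^ 1 ∣ f - g) : f.coeff 0 = g.coeff 0 := by
  have := X_pow_dvd_iff.mp h 0 (by norm_num)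
  rwa [coeff_sub, sub_eq_zero] at this

theorem isTransition_swap {δ : ℤ} {v₀ : Fin 2 → K[X]} (hδ : 0 < δ) (hg : (v₀ 1).coeff 0 ≠ 0) :
    IsTransition 1 δ v₀ (1 - δ)
      !![0, X; C ((v₀ 1).coeff 0), C (-(v₀ 0).coeff 0)] := by
  intro v hv
  have h0 := coeff_zero_eq_of_dvd (hv 0)
  have h1 := coeff_zero_eq_of_dvd (hv 1)
  rw [Function.iterate_one, divstep, if_pos ⟨hδ, by rwa [h1]⟩]
  refine ⟨rfl, fun i => ?_⟩
  fin_cases i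
  · simp
  · have := X_mul_divX_sub ((v 1).coeff 0) ((v 0).coeff 0) (v 0) (v 1) (mul_comm _ _)
    rw [pow_one]
    change X * divX _ = C _ * v 0 + C (-_) * v 1
    rw [this, h0, h1, C_neg]
    ring

theorem isTransition_noswap {δ : ℤ} {v₀ : Fin 2 → K[X]} (h : ¬(0 < δ ∧ (v₀ 1).coeff 0 ≠ 0)) :
    IsTransition 1 δ v₀ (1 + δ)
      !![X, 0; C (-(v₀ 1).coeff 0), C ((v₀ 0).coeff 0)] := by
  intro v hv
  have h0 := coeff_zero_eq_of_dvd (hv 0)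
  have h1 := coeff_zero_eq_of_dvd (hv 1)
  rw [Function.iterate_one, divstep, if_neg (by rwa [h1])]
  refine ⟨rfl, fun i => ?_⟩
  fin_cases i
  · simp
  · have := X_mul_divX_sub ((v 0).coeff 0) ((v 1).coeff 0) (v 1) (v 0) (mul_comm _ _)
    rw [pow_one]
    change X * divX _ = C (-_) * v 0 + C _ * v 1
    rw [this, h0, h1, C_neg]
    ring

theorem IsTransition.congr {n : ℕ} {δ δ' : ℤ} {v₀ v₁ : Fin 2 → K[X]}
    {Q : Matrix (Fin 2) (Fin 2) K[X]} (h : IsTransition n δ v₀ δ' Q)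
    (hv : ∀ i, X ^ n ∣ v₁ i - v₀ i) : IsTransition n δ v₁ δ' Q := fun v hvv =>
  h v fun i => by simpa using dvd_add (hvv i) (hv i)

/-- `Q₁ v₀` is `X^n` times the vector after `n` steps. If `v₀` is known modulo `X^(2n)`, its second
block of length `n` is that vector modulo `X^n`, which determines the next `n` steps. -/
theorem IsTransition.comp {n : ℕ} {δ δ₁ δ₂ : ℤ} {v₀ : Fin 2 → K[X]}
    {Q₁ Q₂ : Matrix (Fin 2) (Fin 2) K[X]} (h₁ : IsTransition n δ v₀ δ₁ Q₁)
    (h₂ : IsTransition n δ₁ (fun i => blk n 1 (Q₁ i 0 * v₀ 0 + Q₁ i 1 * v₀ 1)) δ₂ Q₂) :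
    IsTransition (n + n) δ v₀ δ₂ (Q₂ * Q₁) := by
  intro v hv
  obtain ⟨hδ, hQ⟩ := h₁ v fun i => (pow_dvd_pow _ (by omega)).trans (hv i)
  set w := (divstep^[n] (δ, v)).2 with hw
  have hst : divstep^[n] (δ, v) = (δ₁, w) := Prod.ext hδ rfl
  obtain ⟨hδ₂, hQ₂⟩ := h₂ w fun i => by
    rw [X_pow_dvd_iff]
    intro d hd
    have h3 : X ^ (n + n) ∣ X ^ n * w i - (Q₁ i 0 * v₀ 0 + Q₁ i 1 * v₀ 1) := by
      rw [hQ i]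
      have : Q₁ i 0 * v 0 + Q₁ i 1 * v 1 - (Q₁ i 0 * v₀ 0 + Q₁ i 1 * v₀ 1) =
          Q₁ i 0 * (v 0 - v₀ 0) + Q₁ i 1 * (v 1 - v₀ 1) := by ring
      rw [this]
      exact dvd_add ((hv 0).mul_left _) ((hv 1).mul_left _)
    have h4 := X_pow_dvd_iff.mp h3 (d + n) (by omega)
    rw [coeff_sub, coeff_X_pow_mul] at h4
    rw [coeff_sub, coeff_blk, if_pos hd, mul_one, add_comm n d, h4]
  rw [Function.iterate_add_apply, hst]
  refine ⟨hδ₂, fun i => ?_⟩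
  have h5 := hQ₂ i
  have h6 := hQ 0
  have h7 := hQ 1
  rw [Matrix.mul_apply, Matrix.mul_apply, Fin.sum_univ_two, Fin.sum_univ_two, pow_add]
  linear_combination X ^ n * h5 + Q₂ i 0 * h6 + Q₂ i 1 * h7

end divstep

/-! ### Divide and conquer for division steps. -/

section jump

variable {I : Type*} {F : I → Type v} [∀ ι, Field (F ι)]

/-- The value of a polynomial over the ring of all values at an instance. -/
noncomputable def at_ (ι : I) (P : (∀ ι, F ι)[X]) : (F ι)[X] := P.map (Pi.evalRingHom F ι)

theorem coeff_at (ι : I) (P : (∀ ι, F ι)[X]) (n : ℕ) : (at_ ι P).coeff n = P.coeff n ι := by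
  simp [at_, coeff_map]

theorem at_blk (ι : I) (t j : ℕ) (P : (∀ ι, F ι)[X]) : at_ ι (blk t j P) = blk t j (at_ ι P) := by
  ext i
  rw [coeff_at, coeff_blk, coeff_blk, coeff_at]
  split_ifs <;> rfl

theorem at_add (ι : I) (P Q : (∀ ι, F ι)[X]) : at_ ι (P + Q) = at_ ι P + at_ ι Q :=
  Polynomial.map_add _

theorem at_mul (ι : I) (P Q : (∀ ι, F ι)[X]) : at_ ι (P * Q) = at_ ι P * at_ ι Q :=
  Polynomial.map_mul _

/-- The cost of computing `2 ^ k` division steps with a multiplication algorithm of cost `M`. -/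
def jumpCost (M : ℕ → ℕ) : ℕ → ℕ
  | 0 => 2
  | k + 1 => 2 * jumpCost M k + 12 * M (k + 1) + 6 * 2 ^ (k + 2)

/-- The set of all coefficients of the entries of a matrix. -/
def matCf {R : Type*} [CommRing R] (Q : Matrix (Fin 2) (Fin 2) R[X]) : Set R :=
  ⋃ i, ⋃ j, cf (Q i j)

theorem cf_subset_matCf {R : Type*} [CommRing R] (Q : Matrix (Fin 2) (Fin 2) R[X]) (i j : Fin 2) :
    cf (Q i j) ⊆ matCf Q :=
  Set.subset_iUnion₂ (s := fun i j => cf (Q i j)) i j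

theorem SLP.iUnion_fin_two {R : Type*} [CommRing R] {Ω : Set R} {l w c : ℕ} {A : Set R}
    {f : Fin 2 → Set R} (h : ∀ i, SLP Ω l w A c (f i)) : SLP Ω l w A (2 * c) (⋃ i, f i) := by
  refine ((h 0).union (h 1)).mono le_rfl (Set.iUnion_subset fun i => ?_) (by omega)
  fin_cases i
  exacts [Set.subset_union_left, Set.subset_union_right]

theorem SLP.mul_add_mul {V : Type*} [CommRing V] {Ω A : Set V} {M : ℕ → ℕ} (hM : FastMul Ω M)
    (h0 : (0 : V) ∈ A) {k : ℕ} {P Q P' Q' : V[X]} (hP : P.degree < (2 ^ k : ℕ))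
    (hQ : Q.degree < (2 ^ k : ℕ)) (hP' : P'.degree < (2 ^ k : ℕ)) (hQ' : Q'.degree < (2 ^ k : ℕ))
    (hPA : cf P ⊆ A) (hQA : cf Q ⊆ A) (hPA' : cf P' ⊆ A) (hQA' : cf Q' ⊆ A) :
    SLP Ω 1 1 A (2 * M k + 2 ^ (k + 1)) (cf (P * Q + P' * Q')) := by
  have h1 := (hM k A h0 P Q hP hQ hPA hQA).union (hM k A h0 P' Q' hP' hQ' hPA' hQA')
  refine (h1.trans (SLP.poly_add (n := 2 ^ k + 2 ^ k) (.inl h0) (degree_mul_lt_add hP hQ)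
    (degree_mul_lt_add hP' hQ') (Set.subset_union_of_subset_right Set.subset_union_left _)
    (Set.subset_union_of_subset_right Set.subset_union_right _))).mono le_rfl le_rfl ?_
  rw [pow_succ]
  omega

/-- Stated with a continuation: the zero tests split the instances, and on each part the transition
matrix is given by one matrix over the product ring, so the rest of the algorithm has to be supplied
for every leaf. -/
theorem Achieves.jump {Ω : Set (∀ ι, F ι)} {M : ℕ → ℕ} (hM : FastMul Ω M) {m : ℕ}
    {G : ∀ ι, Fin m → F ι} (k : ℕ) : ∀ (δ : ℤ) (v : Fin 2 → (∀ ι, F ι)[X]) (S : Set I)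
    (A : Set (∀ ι, F ι)) (c : ℕ), 0 ∈ A → 1 ∈ A → Ω ⊆ A → (∀ i, (v i).degree < (2 ^ k : ℕ)) →
    (∀ i, cf (v i) ⊆ A) →
    (∀ (S' : Set I) (δ' : ℤ) (Q : Matrix (Fin 2) (Fin 2) (∀ ι, F ι)[X]), S' ⊆ S →
      (∀ i j, (Q i j).degree ≤ (2 ^ k : ℕ)) →
      (∀ ι ∈ S', IsTransition (2 ^ k) δ (fun i => at_ ι (v i)) δ' (fun i j => at_ ι (Q i j))) →
      Achieves S' (A ∪ matCf Q) G c) →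
    Achieves S A G (c + jumpCost M k) := by
  induction k with
  | zero =>
    intro δ v S A c h0 h1 hΩ hv hvA hG
    have hneg : ∀ x ∈ A, SLP Ω 1 1 A 1 {-x} := fun x hx => by
      rw [← zero_sub]
      exact SLP.singleton_sub h0 hx
    have hcfC : ∀ (x : ∀ ι, F ι) (B : Set (∀ ι, F ι)), 0 ∈ B → x ∈ B → cf (C x) ⊆ B := by
      intro x B h0 hx
      rw [cf_subset_iff]
      intro i
      rw [coeff_C]
      split_ifs
      exacts [hx, h0]
    have hcfX : ∀ (B : Set (∀ ι, F ι)), 0 ∈ B → 1 ∈ B → cf (X : (∀ ι, F ι)[X]) ⊆ B := by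
      intro B h0 h1
      rw [cf_subset_iff]
      intro i
      rw [coeff_X]
      split_ifs
      exacts [h1, h0]
    have hdC : ∀ x : (∀ ι, F ι), (C x).degree ≤ (2 ^ 0 : ℕ) := fun x =>
      degree_C_le.trans (by norm_num)
    have hdX : (X : (∀ ι, F ι)[X]).degree ≤ (2 ^ 0 : ℕ) := degree_X_le.trans (by norm_num)
    have noswap : ∀ S' ⊆ S, (∀ ι ∈ S', ¬(0 < δ ∧ (v 1).coeff 0 ι ≠ 0)) →
        Achieves S' A G (c + 1) := by
      intro S' hS' hno
      rw [add_comm]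
      refine Achieves.slp (hneg _ (hvA 1 ⟨0, rfl⟩)) hΩ ((hG S' (1 + δ)
        !![X, 0; C (-(v 1).coeff 0), C ((v 0).coeff 0)] hS' ?_ ?_).mono le_rfl ?_ le_rfl)
      · intro i j
        fin_cases i <;> fin_cases j
        · exact hdX
        · simp
        · exact hdC _
        · exact hdC _
      · intro ι hι
        have h2 := isTransition_noswap (v₀ := fun i => at_ ι (v i)) (δ := δ)
          (by rw [coeff_at]; exact hno ι hι)
        refine Eq.mp (congrArg _ ?_) h2
        ext i j : 2
        fin_cases i <;> fin_cases j <;> simp [at_, coeff_map]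
      · refine Set.union_subset Set.subset_union_left (Set.iUnion₂_subset fun i j => ?_)
        fin_cases i <;> fin_cases j
        · exact hcfX _ (.inl h0) (.inl h1)
        · exact cf_zero_subset (.inl h0)
        · exact hcfC _ _ (.inl h0) (.inr rfl)
        · exact hcfC _ _ (.inl h0) (.inl (hvA 0 ⟨0, rfl⟩))
    have swap : ∀ S' ⊆ S, 0 < δ → (∀ ι ∈ S', (v 1).coeff 0 ι ≠ 0) →
        Achieves S' A G (c + 1) := by
      intro S' hS' hδ hno
      rw [add_comm]
      refine Achieves.slp (hneg _ (hvA 0 ⟨0, rfl⟩)) hΩ ((hG S' (1 - δ)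
        !![0, X; C ((v 1).coeff 0), C (-(v 0).coeff 0)] hS' ?_ ?_).mono le_rfl ?_ le_rfl)
      · intro i j
        fin_cases i <;> fin_cases j
        · simp
        · exact hdX
        · exact hdC _
        · exact hdC _
      · intro ι hι
        have h2 := isTransition_swap (v₀ := fun i => at_ ι (v i)) hδ
          (by rw [coeff_at]; exact hno ι hι)
        refine Eq.mp (congrArg _ ?_) h2
        ext i j : 2
        fin_cases i <;> fin_cases j <;> simp [at_, coeff_map]
      · refine Set.union_subset Set.subset_union_left (Set.iUnion₂_subset fun i j => ?_)
        fin_cases i <;> fin_cases j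
        · exact cf_zero_subset (.inl h0)
        · exact hcfX _ (.inl h0) (.inl h1)
        · exact hcfC _ _ (.inl h0) (.inl (hvA 1 ⟨0, rfl⟩))
        · exact hcfC _ _ (.inl h0) (.inr rfl)
    refine Achieves.test (c := c + 1) (hvA 1 ⟨0, rfl⟩)
      (noswap _ (Set.sep_subset _ _) fun ι hι h => h.2 hι.2) ?_
    -- `δ` is determined by the branch of the tree, so its sign is known without a test.
    by_cases hδ : 0 < δ
    · exact swap _ (Set.sep_subset _ _) hδ fun ι hι => hι.2
    · exact noswap _ (Set.sep_subset _ _) fun ι _ h => hδ h.1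
  | succ k ih =>
    intro δ v S A c h0 h1 hΩ hv hvA hG
    have hlt : 2 ^ k < 2 ^ (k + 1) := Nat.pow_lt_pow_right (by norm_num) (by omega)
    have h2k : 2 ^ (k + 1) = 2 ^ k + 2 ^ k := by rw [pow_succ]; omega
    -- Transition entries can have degree exactly `2^k`, hence products of size `2^(k+1)`: eight for
    -- the matrix product (`cost₂`) and four for the intermediate vector (`cost₁`).
    set cost₂ := 2 * (2 * (2 * M (k + 1) + 2 ^ (k + 2))) with hcost₂
    set cost₁ := 2 * (2 * M (k + 1) + 2 ^ (k + 2)) with hcost₁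
    refine (ih δ (fun i => blk (2 ^ k) 0 (v i)) S A (c + cost₂ + jumpCost M k + cost₁) h0 h1 hΩ
      (fun i => degree_blk _ _ _) (fun i => cf_blk h0 (hvA i) _ _) ?_).mono le_rfl le_rfl ?_
    · intro S₁ δ₁ Q₁ hS₁ hQ₁ ht₁
      have hQ₁' : ∀ i j, (Q₁ i j).degree < (2 ^ (k + 1) : ℕ) := fun i j =>
        (hQ₁ i j).trans_lt (by exact_mod_cast hlt)
      set w : Fin 2 → (∀ ι, F ι)[X] := fun i => Q₁ i 0 * v 0 + Q₁ i 1 * v 1 with hw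
      have hs₁ : SLP Ω 1 1 (A ∪ matCf Q₁) cost₁ (⋃ i, cf (w i)) := SLP.iUnion_fin_two fun i =>
        SLP.mul_add_mul hM (.inl h0) (hQ₁' _ _) (hv _) (hQ₁' _ _) (hv _)
          ((cf_subset_matCf _ _ _).trans Set.subset_union_right)
          ((hvA _).trans Set.subset_union_left)
          ((cf_subset_matCf _ _ _).trans Set.subset_union_right)
          ((hvA _).trans Set.subset_union_left)
      rw [add_comm _ cost₁]
      refine Achieves.slp hs₁ (hΩ.trans Set.subset_union_left) ?_
      set A₁ := A ∪ matCf Q₁ ∪ ⋃ i, cf (w i) with hA₁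
      have hAA₁ : A ⊆ A₁ := Set.subset_union_left.trans Set.subset_union_left
      refine ih δ₁ (fun i => blk (2 ^ k) 1 (w i)) S₁ A₁ (c + cost₂) (hAA₁ h0) (hAA₁ h1)
        (hΩ.trans hAA₁) (fun i => degree_blk _ _ _) (fun i => cf_blk (hAA₁ h0)
          ((Set.subset_iUnion (fun i => cf (w i)) i).trans Set.subset_union_right) _ _) ?_
      intro S₂ δ₂ Q₂ hS₂ hQ₂ ht₂
      have hQ₂' : ∀ i j, (Q₂ i j).degree < (2 ^ (k + 1) : ℕ) := fun i j =>
        (hQ₂ i j).trans_lt (by exact_mod_cast hlt)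
      have hs₂ : SLP Ω 1 1 (A₁ ∪ matCf Q₂) cost₂ (matCf (Q₂ * Q₁)) :=
        SLP.iUnion_fin_two fun i => SLP.iUnion_fin_two fun j => by
          rw [Matrix.mul_apply, Fin.sum_univ_two]
          have hQ₁A : ∀ i j, cf (Q₁ i j) ⊆ A₁ ∪ matCf Q₂ := fun i j =>
            (cf_subset_matCf Q₁ i j).trans ((Set.subset_union_right.trans
              Set.subset_union_left).trans Set.subset_union_left)
          have hQ₂A : ∀ i j, cf (Q₂ i j) ⊆ A₁ ∪ matCf Q₂ := fun i j =>
            (cf_subset_matCf Q₂ i j).trans Set.subset_union_right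
          exact SLP.mul_add_mul hM (.inl (hAA₁ h0)) (hQ₂' _ _) (hQ₁' _ _) (hQ₂' _ _) (hQ₁' _ _)
            (hQ₂A _ _) (hQ₁A _ _) (hQ₂A _ _) (hQ₁A _ _)
      rw [add_comm c]
      refine Achieves.slp hs₂ (hΩ.trans (hAA₁.trans Set.subset_union_left)) ?_
      refine (hG S₂ δ₂ (Q₂ * Q₁) (hS₂.trans hS₁) (fun i j => ?_) fun ι hι => ?_).mono le_rfl
        (Set.union_subset_union_left _ (hAA₁.trans Set.subset_union_left)) le_rfl
      · rw [Matrix.mul_apply, Fin.sum_univ_two, h2k]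
        refine (degree_add_le _ _).trans (max_le ?_ ?_) <;>
          exact (degree_mul_le_of_le (hQ₂ _ _) (hQ₁ _ _)).trans (by exact_mod_cast le_rfl)
      · rw [h2k]
        have hmul : (fun i j => at_ ι ((Q₂ * Q₁) i j)) =
            (Matrix.of fun i j => at_ ι (Q₂ i j)) * (Matrix.of fun i j => at_ ι (Q₁ i j)) := by
          ext i j : 2
          simp only [Matrix.mul_apply, Fin.sum_univ_two, at_add, at_mul, Matrix.of_apply]
        rw [hmul]
        refine IsTransition.comp (δ₁ := δ₁) ((ht₁ ι (hS₂ hι)).congr fun i => ?_) ?_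
        · rw [X_pow_dvd_iff]
          intro d hd
          rw [at_blk, coeff_sub, coeff_blk, if_pos hd, mul_zero, zero_add, sub_self]
        · have hv₁ : (fun i => at_ ι (blk (2 ^ k) 1 (w i))) = fun i => blk (2 ^ k) 1
              (at_ ι (Q₁ i 0) * at_ ι (v 0) + at_ ι (Q₁ i 1) * at_ ι (v 1)) := by
            funext i
            rw [at_blk, ← at_mul, ← at_mul, ← at_add]
          have h2 := ht₂ ι hι
          rw [hv₁] at h2
          exact h2
    · rw [jumpCost, hcost₁, hcost₂]
      omega

end jump

/-! ### Termination of the division steps for coprime pairs. -/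

section divstep_inverse

variable {K : Type*} [Field K]

theorem coeff_divX_sub (a b : K) (f g : K[X]) (i : ℕ) :
    (divX (C a * f - C b * g)).coeff i = a * f.coeff (i + 1) - b * g.coeff (i + 1) := by
  rw [coeff_divX, coeff_sub, coeff_C_mul, coeff_C_mul]

theorem dvd_of_dvd_divX {a b : K} {f g e : K[X]} (ha : a ≠ 0)
    (h : a * f.coeff 0 = b * g.coeff 0) (h1 : e ∣ divX (C a * f - C b * g)) (h2 : e ∣ g) :
    e ∣ f := by
  have h3 : e ∣ C a * f := by
    have := (h1.mul_left X)
    rw [X_mul_divX_sub _ _ _ _ h] at this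
    simpa using dvd_add this (h2.mul_left (C b))
  exact (IsUnit.dvd_mul_left (isUnit_C.mpr ha.isUnit)).mp h3

/-- Degree bounds and common divisors during the division steps from `(1, v₀)`. -/
theorem divstep_invariant {d : ℕ} {v₀ : Fin 2 → K[X]} (h0 : (v₀ 0).coeff 0 ≠ 0)
    (hd0 : ∀ i, (v₀ 0).coeff i ≠ 0 → i ≤ d) (hd1 : ∀ i, (v₀ 1).coeff i ≠ 0 → i < d) (n : ℕ) :
    (((divstep^[n] (1, v₀)).2 0).coeff 0 ≠ 0) ∧
    (∀ i, ((divstep^[n] (1, v₀)).2 0).coeff i ≠ 0 →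
      2 * (i : ℤ) ≤ 2 * d - 1 - n + (divstep^[n] (1, v₀)).1) ∧
    (∀ i, ((divstep^[n] (1, v₀)).2 1).coeff i ≠ 0 →
      2 * (i : ℤ) ≤ 2 * d - 1 - n - (divstep^[n] (1, v₀)).1) ∧
    ∀ e, e ∣ (divstep^[n] (1, v₀)).2 0 → e ∣ (divstep^[n] (1, v₀)).2 1 → e ∣ v₀ 0 ∧ e ∣ v₀ 1 := by
  induction n with
  | zero =>
    refine ⟨h0, fun i hi => ?_, fun i hi => ?_, fun e he he' => ⟨he, he'⟩⟩
    · have := hd0 i hi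
      simp only [Function.iterate_zero, id]
      push_cast
      omega
    · have := hd1 i hi
      simp only [Function.iterate_zero, id]
      push_cast
      omega
  | succ n ih =>
    rw [Function.iterate_succ_apply']
    generalize divstep^[n] (1, v₀) = st at ih ⊢
    obtain ⟨δ, v⟩ := st
    obtain ⟨i1, i2, i3, i4⟩ := ih
    simp only at i1 i2 i3 i4
    by_cases h : 0 < δ ∧ (v 1).coeff 0 ≠ 0
    · rw [divstep, if_pos h]
      refine ⟨h.2, fun i hi => ?_, fun i hi => ?_, fun e he he' => ?_⟩
      · have := i3 i hi
        push_cast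
        omega
      · replace hi : (divX (C ((v 1).coeff 0) * v 0 - C ((v 0).coeff 0) * v 1)).coeff i ≠ 0 := hi
        rw [coeff_divX_sub] at hi
        have : (v 0).coeff (i + 1) ≠ 0 ∨ (v 1).coeff (i + 1) ≠ 0 := by
          by_contra! hc
          rw [hc.1, hc.2] at hi
          simp at hi
        rcases this with h1 | h1
        · have := i2 _ h1
          push_cast at this ⊢
          omega
        · have := i3 _ h1
          push_cast at this ⊢
          omega
      · have he1 : e ∣ v 1 := he
        exact i4 e (dvd_of_dvd_divX h.2 (mul_comm _ _) he' he1) he1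
    · rw [divstep, if_neg h]
      refine ⟨i1, fun i hi => ?_, fun i hi => ?_, fun e he he' => ?_⟩
      · have := i2 i hi
        push_cast
        omega
      · replace hi : (divX (C ((v 0).coeff 0) * v 1 - C ((v 1).coeff 0) * v 0)).coeff i ≠ 0 := hi
        rw [coeff_divX_sub] at hi
        by_cases h1 : (v 1).coeff (i + 1) = 0
        · have h2 : (v 0).coeff (i + 1) ≠ 0 := fun hc => by simp [hc, h1] at hi
          have h3 : (v 1).coeff 0 ≠ 0 := fun hc => by simp [hc, h1] at hi
          -- A contribution of `v 0` to this coefficient requires `(v 1).coeff 0 ≠ 0`; as no swap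
          -- took place, `δ ≤ 0`, and the bound for `v 0` is at least as strong as that for `v 1`.
          have h4 : δ ≤ 0 := not_lt.mp fun hc => h ⟨hc, h3⟩
          have := i2 _ h2
          push_cast at this ⊢
          omega
        · have := i3 _ h1
          push_cast at this ⊢
          omega
      · have he0 : e ∣ v 0 := he
        exact i4 e he0 (dvd_of_dvd_divX i1 (mul_comm _ _) he' he0)

/-- After `2 * d` division steps a coprime pair is transformed into a constant and zero. -/
theorem exists_const_of_isTransition {d n : ℕ} (hn : 2 * d ≤ n) {v₀ : Fin 2 → K[X]}
    (h0 : (v₀ 0).coeff 0 ≠ 0)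
    (hd0 : ∀ i, (v₀ 0).coeff i ≠ 0 → i ≤ d) (hd1 : ∀ i, (v₀ 1).coeff i ≠ 0 → i < d)
    (hu : ∀ e, e ∣ v₀ 0 → e ∣ v₀ 1 → IsUnit e) {δ' : ℤ} {Q : Matrix (Fin 2) (Fin 2) K[X]}
    (hQ : IsTransition n 1 v₀ δ' Q) :
    ∃ c : K, c ≠ 0 ∧ v₀ 0 ∣ Q 0 1 * v₀ 1 - C c * X ^ n := by
  obtain ⟨i1, i2, i3, i4⟩ := divstep_invariant h0 hd0 hd1 n
  have h1 := (hQ v₀ fun i => by simp).2 0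
  generalize divstep^[n] (1, v₀) = st at i1 i2 i3 i4 h1
  obtain ⟨δ, v⟩ := st
  simp only at i1 i2 i3 i4 h1
  -- The nonzero constant coefficient of `v 0` forces `δ ≥ n + 1 - 2d > 0`; the degree bound for `v
  -- 1` is then negative.
  have h2 : v 1 = 0 := by
    ext i
    by_contra hi
    have h3 := i3 i hi
    have h4 := i2 0 i1
    push_cast at h4
    omega
  have h3 : IsUnit (v 0) := by
    have := i4 (v 0) dvd_rfl (by rw [h2]; exact dvd_zero _)
    exact hu _ this.1 this.2
  obtain ⟨c, hc, hc'⟩ := Polynomial.isUnit_iff.mp h3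
  refine ⟨c, hc.ne_zero, -Q 0 0, ?_⟩
  rw [← hc'] at h1
  linear_combination -h1

end divstep_inverse

/-! ### Cyclic correlation as multiplication modulo `X^s - 1`. -/

section cyclic

theorem sum_shift_mul_pow {S : Type*} [CommRing S] {s : ℕ} {x : S} (hx : x ^ s = 1) {β : ℕ → S}
    (hβ : ∀ k, β (k + s) = β k) (i : ℕ) :
    x ^ i * ∑ j ∈ Finset.range s, β (i + j) * x ^ j = ∑ k ∈ Finset.range s, β k * x ^ k := by
  induction i with
  | zero => simp
  | succ i ih =>
    rw [← ih, Finset.mul_sum, Finset.mul_sum]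
    have h1 : ∀ j, x ^ (i + 1) * (β (i + 1 + j) * x ^ j) =
        (fun j => x ^ i * (β (i + j) * x ^ j)) (j + 1) := fun j => by
      simp only [pow_succ, add_assoc, add_comm 1 j]
      ring
    rw [Finset.sum_congr rfl fun j _ => h1 j]
    have h2 := Finset.sum_range_succ (fun j => x ^ i * (β (i + j) * x ^ j)) s
    rw [Finset.sum_range_succ'] at h2
    rw [hβ, hx, add_zero, pow_zero] at h2
    exact add_right_cancel h2

/-- Shifting a periodic sequence by `i` amounts to multiplying its generating sum by `x^(-i)`,
written `x^(s-i)`. The extra factor `x^N` matches the power of `X` left over by the division steps.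
-/
theorem pow_mul_correlation {S : Type*} [CommRing S] {s : ℕ} {x : S} (hx : x ^ s = 1)
    {β : ℕ → S} (hβ : ∀ k, β (k + s) = β k) (a : ℕ → S) (N : ℕ) :
    x ^ N * ∑ j ∈ Finset.range s, (∑ i ∈ Finset.range s, a i * β (i + j)) * x ^ j =
      (∑ k ∈ Finset.range s, β k * x ^ k) * ∑ i ∈ Finset.range s, a i * x ^ (N + (s - i)) := by
  have h1 : ∑ j ∈ Finset.range s, (∑ i ∈ Finset.range s, a i * β (i + j)) * x ^ j =
      ∑ i ∈ Finset.range s, a i * ∑ j ∈ Finset.range s, β (i + j) * x ^ j := by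
    simp only [Finset.sum_mul, Finset.mul_sum]
    rw [Finset.sum_comm]
    simp only [mul_assoc]
  rw [h1, Finset.mul_sum, Finset.mul_sum]
  refine Finset.sum_congr rfl fun i hi => ?_
  have h2 : x ^ (s - i) * x ^ i = 1 := by
    rw [← pow_add, Nat.sub_add_cancel (Finset.mem_range.mp hi).le, hx]
  rw [← sum_shift_mul_pow hx hβ i, pow_add]
  linear_combination (-(x ^ N * a i * ∑ j ∈ Finset.range s, β (i + j) * x ^ j)) * h2

variable {K : Type*} [CommRing K]

/-- The polynomial of degree `< s` with coefficients `u 0, …, u (s - 1)`. -/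
noncomputable def seqPoly (s : ℕ) (u : ℕ → K) : K[X] := ∑ k ∈ Finset.range s, C (u k) * X ^ k

/-- The coefficients `u i` at the positions `N - i` modulo `s`. -/
noncomputable def revPoly (s N : ℕ) (u : ℕ → K) : K[X] :=
  ∑ i ∈ Finset.range s, C (u i) * X ^ ((N + (s - i)) % s)

/-- The cyclic correlation of two sequences. -/
def corr (s : ℕ) (β a : ℕ → K) (j : ℕ) : K := ∑ i ∈ Finset.range s, a i * β (i + j)

theorem coeff_seqPoly (s : ℕ) (u : ℕ → K) (k : ℕ) :
    (seqPoly s u).coeff k = if k < s then u k else 0 := by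
  simp [seqPoly, coeff_X_pow]

theorem degree_seqPoly (s : ℕ) (u : ℕ → K) : (seqPoly s u).degree < s := by
  rw [degree_lt_iff_coeff_zero]
  intro m hm
  rw [coeff_seqPoly, if_neg (by omega)]

theorem degree_revPoly {s : ℕ} (hs : 0 < s) (N : ℕ) (u : ℕ → K) : (revPoly s N u).degree < s :=
  degree_sum_lt _ _ fun i _ => degree_C_mul_lt _
    ((degree_X_pow_le _).trans_lt (by exact_mod_cast Nat.mod_lt _ hs))

theorem rev_index_injective {s N i i' : ℕ} (hi : i < s) (hi' : i' < s)
    (h : (N + (s - i)) % s = (N + (s - i')) % s) : i = i' := by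
  have h1 : s - i ≡ s - i' [MOD s] := Nat.ModEq.add_left_cancel' N h
  rcases le_total i i' with h2 | h2
  · have h3 := (Nat.modEq_iff_dvd' (by omega : s - i' ≤ s - i)).mp h1.symm
    have := Nat.eq_zero_of_dvd_of_lt h3 (by omega)
    omega
  · have h3 := (Nat.modEq_iff_dvd' (by omega : s - i ≤ s - i')).mp h1
    have := Nat.eq_zero_of_dvd_of_lt h3 (by omega)
    omega

theorem coeff_revPoly {s N i : ℕ} (hi : i < s) (u : ℕ → K) :
    (revPoly s N u).coeff ((N + (s - i)) % s) = u i := by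
  rw [revPoly, finsetSum_coeff, Finset.sum_eq_single i]
  · simp
  · intro i' hi' hne
    rw [coeff_C_mul_X_pow, if_neg]
    exact fun h => hne (rev_index_injective hi (Finset.mem_range.mp hi') h).symm
  · exact fun h => absurd (Finset.mem_range.mpr hi) h

theorem exists_rev_index {s k : ℕ} (hk : k < s) : ∃ i < s, (0 + (s - i)) % s = k := by
  rcases Nat.eq_zero_or_pos k with rfl | h
  · exact ⟨0, hk, by simp⟩
  · exact ⟨s - k, by omega, by
      rw [zero_add, Nat.sub_sub_self hk.le, Nat.mod_eq_of_lt hk]⟩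

theorem revPoly_eq {s : ℕ} {e : K[X]} (he : e.degree < s) :
    revPoly s 0 (fun i => e.coeff ((0 + (s - i)) % s)) = e := by
  ext k
  by_cases hk : k < s
  · obtain ⟨i, hi, rfl⟩ := exists_rev_index hk
    rw [coeff_revPoly hi]
  · rw [(degree_lt_iff_coeff_zero _ _).mp he k (by omega)]
    rcases Nat.eq_zero_or_pos s with rfl | hs
    · simp [revPoly]
    · exact (degree_lt_iff_coeff_zero _ _).mp (degree_revPoly hs _ _) k (by omega)

theorem cf_revPoly {s : ℕ} {A : Set K} (h0 : 0 ∈ A) {u : ℕ → K} (hu : ∀ i < s, u i ∈ A) :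
    cf (revPoly s 0 u) ⊆ A := by
  rw [cf_subset_iff]
  intro k
  by_cases hk : k < s
  · obtain ⟨i, hi, rfl⟩ := exists_rev_index hk
    rw [coeff_revPoly hi]
    exact hu i hi
  · rcases Nat.eq_zero_or_pos s with rfl | hs
    · simpa [revPoly] using h0
    · rw [(degree_lt_iff_coeff_zero _ _).mp (degree_revPoly hs _ _) k (by omega)]
      exact h0

theorem cf_seqPoly {s : ℕ} {A : Set K} (h0 : 0 ∈ A) {u : ℕ → K} (hu : ∀ i < s, u i ∈ A) :
    cf (seqPoly s u) ⊆ A := by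
  rw [cf_subset_iff]
  intro k
  rw [coeff_seqPoly]
  split_ifs with h
  exacts [hu k h, h0]

theorem dvd_correlation {s : ℕ} {β : ℕ → K} (hβ : ∀ k, β (k + s) = β k) (a : ℕ → K) (N : ℕ) :
    X ^ s - 1 ∣ X ^ N * seqPoly s (corr s β a) - seqPoly s β * revPoly s N a := by
  set x := AdjoinRoot.mk (X ^ s - 1 : K[X]) X with hxdef
  have hx : x ^ s = 1 := by
    have : AdjoinRoot.mk (X ^ s - 1 : K[X]) (X ^ s - 1) = 0 := AdjoinRoot.mk_self
    rwa [map_sub, map_pow, map_one, sub_eq_zero] at this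
  have hmod : ∀ k, x ^ (k % s) = x ^ k := by
    intro k
    conv_rhs => rw [← Nat.div_add_mod k s, pow_add, pow_mul, hx, one_pow, one_mul]
  have h1 := pow_mul_correlation hx (β := fun k => AdjoinRoot.mk (X ^ s - 1 : K[X]) (C (β k)))
    (fun k => by rw [hβ]) (fun k => AdjoinRoot.mk (X ^ s - 1 : K[X]) (C (a k))) N
  rw [← AdjoinRoot.mk_eq_mk]
  simp only [seqPoly, revPoly, corr, map_mul, map_sum, map_pow, ← hxdef, hmod]
  exact h1

/-- The `j`-th coefficient of the reduction modulo `X ^ s - 1` of a polynomial of degree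
`< 16 * s`. -/
def fold (s j : ℕ) (P : K[X]) : K := ∑ q ∈ Finset.range 16, P.coeff (s * q + j)

/-- For `s > 0`, `X` is a unit modulo `X^s - 1` with inverse `X^(s-1)`; for `s = 0` the modulus is
`0` and `X^N` is not a zero divisor. -/
theorem dvd_of_dvd_X_pow_mul {s N : ℕ} {P : K[X]} (h : X ^ s - 1 ∣ X ^ N * P) :
    X ^ s - 1 ∣ P := by
  rcases Nat.eq_zero_or_pos s with rfl | hs
  · simp only [pow_zero, sub_self, zero_dvd_iff] at h ⊢
    ext i
    have := congrArg (fun p => coeff p (i + N)) h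
    simpa [coeff_X_pow_mul] using this
  obtain ⟨s', rfl⟩ := Nat.exists_eq_succ_of_ne_zero hs.ne'
  have h1 : (X ^ s'.succ - 1 : K[X]) ∣ X ^ (s'.succ * N) - 1 := by
    have := X_pow_sub_one_dvd_X_pow_sub (V := K) s'.succ (s'.succ * N)
    rwa [Nat.mul_mod_right, pow_zero] at this
  have h2 : P = X ^ (s' * N) * (X ^ N * P) - (X ^ (s'.succ * N) - 1) * P := by
    rw [Nat.succ_mul, pow_add]
    ring
  rw [h2]
  exact dvd_sub (h.mul_left _) (h1.mul_right _)

end cyclic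

/-! ### Folding modulo `X^s - 1` and inverting a correlation over a field. -/

section cyclic_field

variable {K : Type*} [Field K]

theorem monic_X_pow_sub_one {s : ℕ} (hs : 0 < s) : (X ^ s - 1 : K[X]).Monic := by
  rw [← C_1]
  exact monic_X_pow_sub_C _ hs.ne'

theorem degree_X_pow_sub_one' {s : ℕ} (hs : 0 < s) : (X ^ s - 1 : K[X]).degree = s := by
  rw [← C_1]
  exact degree_X_pow_sub_C hs _

theorem eq_of_dvd_sub_of_degree_lt {s : ℕ} (hs : 0 < s) {P Q : K[X]} (hP : P.degree < s)
    (hQ : Q.degree < s) (h : X ^ s - 1 ∣ P - Q) : P = Q := by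
  rw [← sub_eq_zero]
  refine eq_zero_of_dvd_of_degree_lt h ?_
  rw [degree_X_pow_sub_one' hs]
  exact (degree_sub_le _ _).trans_lt (max_lt hP hQ)

theorem fold_eq {s : ℕ} (hs : 0 < s) {P Q : K[X]} (hP : P.degree < (s * 16 : ℕ))
    (hQ : Q.degree < s) (h : X ^ s - 1 ∣ P - Q) {j : ℕ} (hj : j < s) :
    fold s j P = Q.coeff j := by
  have h1 : ∑ q ∈ Finset.range 16, blk s q P = Q := by
    refine eq_of_dvd_sub_of_degree_lt hs (degree_sum_lt _ _ fun q _ => degree_blk _ _ _) hQ ?_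
    have h2 : X ^ s - 1 ∣ P - ∑ q ∈ Finset.range 16, blk s q P := by
      have h3 := joinBlocks_sub_dvd s 16 (1 : K) fun q => blk s q P
      rw [joinBlocks_blk hs hP] at h3
      simpa using h3
    have h3 : ∑ q ∈ Finset.range 16, blk s q P - Q =
      (P - Q) - (P - ∑ q ∈ Finset.range 16, blk s q P) := by ring
    rw [h3]
    exact dvd_sub h h2
  rw [← h1, finsetSum_coeff, fold]
  refine Finset.sum_congr rfl fun q _ => ?_
  rw [coeff_blk, if_pos hj]

theorem fold_mul_revPoly {s : ℕ} (hs : 0 < s) {β : ℕ → K} (hβ : ∀ k, β (k + s) = β k)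
    (a : ℕ → K) {j : ℕ} (hj : j < s) :
    fold s j (seqPoly s β * revPoly s 0 a) = corr s β a j := by
  rw [fold_eq hs (Q := seqPoly s (corr s β a)) _ (degree_seqPoly _ _) _ hj, coeff_seqPoly,
    if_pos hj]
  · exact (degree_mul_lt_add (degree_seqPoly _ _) (degree_revPoly hs _ _)).trans_le
      (by exact_mod_cast (by omega : s + s ≤ s * 16))
  · have := dvd_correlation hβ a 0
    rw [pow_zero, one_mul, ← dvd_neg, neg_sub] at this
    exact this

/-- With `Q B ≡ c X^N`, the product of `Q` and the transformed polynomial is `c` times the reversal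
of `a`, rotated by `N`. The same reduction of `Q B` is the monomial `c X^(N % s)`, from which `c` is
read off. -/
theorem fold_inverse {s N : ℕ} (hs : 0 < s) {β : ℕ → K} (hβ : ∀ k, β (k + s) = β k) (a : ℕ → K)
    {c : K} {Q : K[X]} (hQ : X ^ s - 1 ∣ Q * seqPoly s β - C c * X ^ N)
    (h1 : (Q * seqPoly s β).degree < (s * 16 : ℕ))
    (h2 : (Q * seqPoly s (corr s β a)).degree < (s * 16 : ℕ)) :
    fold s (N % s) (Q * seqPoly s β) = c ∧
      ∀ i < s, fold s ((N + (s - i)) % s) (Q * seqPoly s (corr s β a)) = c * a i := by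
  constructor
  · rw [fold_eq hs (Q := C c * X ^ (N % s)) h1 _ _ (Nat.mod_lt _ hs), coeff_C_mul_X_pow,
      if_pos rfl]
    · exact degree_C_mul_lt _ ((degree_X_pow_le _).trans_lt (by exact_mod_cast Nat.mod_lt _ hs))
    · have h3 : Q * seqPoly s β - C c * X ^ (N % s) =
          (Q * seqPoly s β - C c * X ^ N) + C c * (X ^ N - X ^ (N % s)) := by ring
      rw [h3]
      exact dvd_add hQ ((X_pow_sub_one_dvd_X_pow_sub _ _).mul_left _)
  · intro i hi
    rw [fold_eq hs (Q := C c * revPoly s N a) h2 (degree_C_mul_lt _ (degree_revPoly hs _ _)) _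
      (Nat.mod_lt _ hs), coeff_C_mul, coeff_revPoly hi]
    refine dvd_of_dvd_X_pow_mul (N := N) ?_
    have h3 : X ^ N * (Q * seqPoly s (corr s β a) - C c * revPoly s N a) =
        Q * (X ^ N * seqPoly s (corr s β a) - seqPoly s β * revPoly s N a) +
          revPoly s N a * (Q * seqPoly s β - C c * X ^ N) := by ring
    rw [h3]
    exact dvd_add ((dvd_correlation hβ a N).mul_left _) (hQ.mul_left _)

/-- If correlation with `β` is injective, then the polynomial of `β` is coprime to `X ^ s - 1`. -/
theorem isUnit_of_dvd_of_dvd {s : ℕ} (hs : 0 < s) {β : ℕ → K} (hβ : ∀ k, β (k + s) = β k)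
    (hinj : ∀ a : ℕ → K, (∀ j < s, corr s β a j = 0) → ∀ i < s, a i = 0) {d : K[X]}
    (h1 : d ∣ X ^ s - 1) (h2 : d ∣ seqPoly s β) : IsUnit d := by
  by_contra hd
  obtain ⟨e, he⟩ := h1
  have hne : (X ^ s - 1 : K[X]) ≠ 0 := (monic_X_pow_sub_one hs).ne_zero
  have hd0 : d ≠ 0 := by rintro rfl; exact hne (by rw [he, zero_mul])
  have he0 : e ≠ 0 := by rintro rfl; exact hne (by rw [he, mul_zero])
  have hdeg : e.degree < s := by
    have h3 := congrArg natDegree he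
    rw [natDegree_mul hd0 he0, natDegree_eq_of_degree_eq_some (degree_X_pow_sub_one' hs)] at h3
    have h4 : 0 < d.natDegree := natDegree_pos_iff_degree_pos.mpr
      (degree_pos_of_ne_zero_of_nonunit hd0 hd)
    rw [← natDegree_lt_iff_degree_lt he0]
    omega
  -- The cofactor `e` of `d` is nonzero of degree `< s` and is killed by `seqPoly s β` modulo `X^s -
  -- 1`; reversed, it is a sequence with vanishing correlation.
  set a : ℕ → K := fun i => e.coeff ((0 + (s - i)) % s) with ha
  have hrev : revPoly s 0 a = e := revPoly_eq hdeg
  have h3 : seqPoly s (corr s β a) = 0 := by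
    refine eq_of_dvd_sub_of_degree_lt hs (degree_seqPoly _ _)
      (by rw [degree_zero]; exact WithBot.bot_lt_coe s) ?_
    have h4 := dvd_correlation hβ a 0
    rw [pow_zero, one_mul, hrev] at h4
    have h5 : X ^ s - 1 ∣ seqPoly s β * e := by
      rw [he]
      exact mul_dvd_mul_right h2 e
    simpa using dvd_add h4 h5
  have h4 := hinj a fun j hj => by
    have := congrArg (fun P => coeff P j) h3
    simpa [coeff_seqPoly, hj] using this
  refine he0 ?_
  rw [← hrev, revPoly]
  exact Finset.sum_eq_zero fun i hi => by rw [h4 i (Finset.mem_range.mp hi), C_0, zero_mul]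

end cyclic_field

/-! ### Linearized polynomials and normal bases. -/

section normal

theorem linPoly_eval {F : Type v} [Field F] (q : ℕ) {s : ℕ} (a : Fin s → F) (x : F) :
    (linPoly q a).eval x = ∑ i : Fin s, a i * x ^ q ^ (i : ℕ) := by
  simp [linPoly, eval_finsetSum]

variable {K : Type u} {F : Type v} [Field K] [Field F] [Algebra K F]

/-- Evaluation of a linearized polynomial as a linear map. -/
theorem exists_linearMap_linPoly [Finite K] {s : ℕ} (a : Fin s → F) :
    ∃ L : F →ₗ[K] F, ∀ x, L x = (linPoly (Nat.card K) a).eval x := by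
  have := Fintype.ofFinite K
  refine ⟨∑ i : Fin s, a i • ((FiniteField.frobeniusAlgHom K F) ^ (i : ℕ)).toLinearMap,
    fun x => ?_⟩
  rw [linPoly_eval, LinearMap.sum_apply]
  refine Finset.sum_congr rfl fun i _ => ?_
  rw [LinearMap.smul_apply, AlgHom.toLinearMap_apply, AlgHom.coe_pow, smul_eq_mul]
  congr 1
  rw [FiniteField.coe_frobeniusAlgHom, pow_iterate, Nat.card_eq_fintype_card]

theorem IsNormalElement.card_eq {E : IntermediateField K F} {s : ℕ} {β : E}
    (h : IsNormalElement K E s β) : Nat.card E = Nat.card K ^ s := by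
  obtain ⟨b, -⟩ := h
  have := Module.Finite.of_basis b
  rw [Module.natCard_eq_pow_finrank (K := K), Module.finrank_eq_card_basis b, Fintype.card_fin]

theorem IsNormalElement.pow_period [Finite F] {E : IntermediateField K F} {s : ℕ} {β : E}
    (h : IsNormalElement K E s β) (k : ℕ) :
    (β : F) ^ Nat.card K ^ (k + s) = (β : F) ^ Nat.card K ^ k := by
  have := Fintype.ofFinite E
  have h1 : β ^ Nat.card K ^ s = β := by
    rw [← h.card_eq, Nat.card_eq_fintype_card, FiniteField.pow_card]
  have h2 : (β : F) ^ Nat.card K ^ s = β := by exact_mod_cast congrArg (Subtype.val) h1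
  rw [add_comm, pow_add, pow_mul, h2]

/-- A linearized polynomial is `K`-linear, so vanishing on the basis means vanishing on all `q^s`
elements of `E`, more than its degree `≤ q^(s-1)` permits. -/
theorem IsNormalElement.injective [Finite K] [Finite F] {E : IntermediateField K F} {s : ℕ} {β : E}
    (h : IsNormalElement K E s β) (a : Fin s → F) (ha : qTransform (Nat.card K) (β : F) a = 0) :
    a = 0 := by
  have := Fintype.ofFinite E
  have hq : 1 < Nat.card K := Finite.one_lt_card
  obtain ⟨L, hL⟩ := exists_linearMap_linPoly (K := K) a
  have hcard := h.card_eq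
  obtain ⟨b, hb⟩ := h
  have h1 : L ∘ₗ E.val.toLinearMap = 0 := by
    refine b.ext fun j => ?_
    rw [LinearMap.comp_apply, hL, hb, LinearMap.zero_apply]
    exact congrFun ha j
  have h2 : linPoly (Nat.card K) a = 0 := by
    rcases Nat.eq_zero_or_pos s with rfl | hs
    · simp [linPoly]
    refine eq_zero_of_natDegree_lt_card_of_eval_eq_zero _ (f := fun x : E => (x : F))
      Subtype.val_injective (fun x => ?_) ?_
    · rw [← hL]
      exact LinearMap.congr_fun h1 x
    · rw [← Nat.card_eq_fintype_card, hcard]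
      refine lt_of_le_of_lt ?_ (Nat.pow_lt_pow_right hq (Nat.sub_lt hs one_pos))
      refine natDegree_sum_le_of_forall_le _ _ fun i _ => (natDegree_C_mul_X_pow_le _ _).trans ?_
      exact Nat.pow_le_pow_right hq.le (by omega)
  funext i
  have h3 := congrArg (fun P => coeff P (Nat.card K ^ (i : ℕ))) h2
  simp only [linPoly, finsetSum_coeff, coeff_C_mul_X_pow, coeff_zero] at h3
  rw [Finset.sum_eq_single i] at h3
  · simpa using h3
  · intro j _ hj
    rw [if_neg]
    intro h4
    exact hj (Fin.ext (Nat.pow_right_injective hq h4).symm)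
  · simp

end normal

/-! ### Both transforms for families of instances. -/

section transform

variable {I : Type*} {F : I → Type v} [∀ ι, Field (F ι)]

theorem at_seqPoly (ι : I) (s : ℕ) (u : ℕ → ∀ ι, F ι) :
    at_ ι (seqPoly s u) = seqPoly s fun k => u k ι := by
  ext k
  rw [coeff_at, coeff_seqPoly, coeff_seqPoly]
  split_ifs <;> rfl

theorem at_revPoly (ι : I) (s N : ℕ) (u : ℕ → ∀ ι, F ι) :
    at_ ι (revPoly s N u) = revPoly s N fun k => u k ι := by
  simp [at_, revPoly, Polynomial.map_sum]

theorem fold_apply (ι : I) (s j : ℕ) (P : (∀ ι, F ι)[X]) :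
    fold s j P ι = fold s j (at_ ι P) := by
  simp only [fold, Finset.sum_apply, coeff_at]

theorem corr_apply (ι : I) (s : ℕ) (β a : ℕ → ∀ ι, F ι) (j : ℕ) :
    corr s β a j ι = corr s (fun k => β k ι) (fun k => a k ι) j := by
  simp only [corr, Finset.sum_apply, Pi.mul_apply]

theorem at_X_pow_sub_one (ι : I) (s : ℕ) : at_ ι (X ^ s - 1 : (∀ ι, F ι)[X]) = X ^ s - 1 := by
  simp [at_]

theorem SLP.fold {R : Type*} [CommRing R] {Ω A : Set R} {w : ℕ} (h0 : 0 ∈ A) (s j : ℕ) {P : R[X]}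
    (hP : cf P ⊆ A) : SLP Ω 1 w A 16 {fold s j P} := by
  rw [_root_.fold]
  simpa using SLP.sum (Ω := Ω) (l := 1) (w := w) (c := 0) (Finset.range 16)
    (fun q => P.coeff (s * q + j)) h0 fun q _ =>
      .done (Set.singleton_subset_iff.mpr (hP ⟨_, rfl⟩))

theorem Achieves.divs {m : ℕ} {S : Set I} {A : Set (∀ ι, F ι)} {G : ∀ ι, Fin m → F ι} {c : ℕ}
    {z : ∀ ι, F ι} (hz : z ∈ A) (hz0 : ∀ ι ∈ S, z ι ≠ 0) (y : ℕ → ∀ ι, F ι) (n : ℕ)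
    (hy : ∀ i < n, y i ∈ A) (h : Achieves S (A ∪ {x | ∃ i < n, x = y i / z}) G c) :
    Achieves S A G (c + n) := by
  induction n generalizing c with
  | zero => simpa using h
  | succ n ih =>
    rw [Nat.add_succ, ← Nat.succ_add]
    refine ih (fun i hi => hy i (by omega)) (Achieves.div (.inl (hy n (by omega))) (.inl hz) hz0
      (h.mono le_rfl ?_ le_rfl))
    rintro x (hx | ⟨i, hi, rfl⟩)
    · exact .inr (.inl hx)
    · rcases Nat.lt_succ_iff_lt_or_eq.mp hi with hi | rfl
      · exact .inr (.inr ⟨i, hi, rfl⟩)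
      · exact .inl rfl

variable {Ω : Set (∀ ι, F ι)} {M : ℕ → ℕ} {s k : ℕ} {A : Set (∀ ι, F ι)}

theorem achieves_corr (hM : FastMul Ω M) (hs : 0 < s) (hk : s ≤ 2 ^ k) {β a : ℕ → ∀ ι, F ι}
    (hβ : ∀ k, β (k + s) = β k) (h0 : 0 ∈ A) (hΩ : Ω ⊆ A) (hβA : ∀ i < s, β i ∈ A)
    (haA : ∀ i < s, a i ∈ A) :
    Achieves Set.univ A (fun ι (j : Fin s) => corr s β a j ι) (M k + s * 16) := by
  have hk' : (s : WithBot ℕ) ≤ (2 ^ k : ℕ) := by exact_mod_cast hk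
  have h1 := hM k A h0 _ _ ((degree_seqPoly s β).trans_le hk') ((degree_revPoly hs 0 a).trans_le hk')
    (cf_seqPoly h0 hβA) (cf_revPoly h0 haA)
  set P := seqPoly s β * revPoly s 0 a with hP
  have h2 := h1.trans (SLP.biUnion (fun j => {fold s j P}) s fun j _ =>
    SLP.fold (.inl h0) s j Set.subset_union_right)
  rw [← Nat.add_zero (M k + s * 16)]
  refine Achieves.slp h2 hΩ (Achieves.output fun j => ⟨fold s j P, .inr ?_, fun ι _ => ?_⟩)
  · exact Set.mem_biUnion (x := (j : ℕ)) j.2 rfl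
  · rw [fold_apply, hP, at_mul, at_seqPoly, at_revPoly,
      fold_mul_revPoly hs (fun k => by rw [hβ]) _ j.2, corr_apply]

/-- The bound `2s ≤ 2^k` provides enough division steps; `2^k ≤ 4s` keeps the products below degree
`16s`, so folding takes `16` blocks. -/
theorem achieves_corr_inverse (hM : FastMul Ω M) (hs : 0 < s) (hk : 2 * s ≤ 2 ^ k)
    (hk4 : 2 ^ k ≤ 4 * s) {β a : ℕ → ∀ ι, F ι} (hβ : ∀ k, β (k + s) = β k)
    (hu : ∀ ι, ∀ e : (F ι)[X], e ∣ X ^ s - 1 → e ∣ (seqPoly s fun k => β k ι) → IsUnit e)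
    (h0 : 0 ∈ A) (h1 : 1 ∈ A) (hneg : -1 ∈ A) (hΩ : Ω ⊆ A) (hβA : ∀ i < s, β i ∈ A)
    (haA : ∀ i < s, corr s β a i ∈ A) :
    Achieves Set.univ A (fun ι (j : Fin s) => a j ι)
      (s + (2 * M (k + 1) + 16 + s * 16) + jumpCost M k) := by
  have hsk : s < 2 ^ k := by omega
  have hkk : 2 ^ k < 2 ^ (k + 1) := Nat.pow_lt_pow_right (by norm_num) (by omega)
  have hco : ∀ i, (X ^ s - 1 : (∀ ι, F ι)[X]).coeff i =
      if i = s then 1 else if i = 0 then -1 else 0 := by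
    intro i
    rw [coeff_sub, coeff_X_pow, coeff_one]
    split_ifs with h2 h3
    · omega
    all_goals simp
  refine Achieves.jump hM k 1 ![X ^ s - 1, seqPoly s β] Set.univ A _ h0 h1 hΩ ?_ ?_ ?_
  · intro i
    fin_cases i
    · refine (degree_lt_iff_coeff_zero _ _).mpr fun m hm => ?_
      change (X ^ s - 1 : (∀ ι, F ι)[X]).coeff m = 0
      rw [hco, if_neg (by omega), if_neg (by omega)]
    · exact (degree_seqPoly s β).trans (by exact_mod_cast hsk)
  · intro i
    fin_cases i
    · rw [cf_subset_iff]
      intro m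
      change (X ^ s - 1 : (∀ ι, F ι)[X]).coeff m ∈ A
      rw [hco]
      split_ifs
      exacts [h1, hneg, h0]
    · exact cf_seqPoly h0 hβA
  intro S δ' Q _ hQdeg hQ
  have hconst : ∀ ι ∈ S, ∃ c : F ι, c ≠ 0 ∧
      X ^ s - 1 ∣ at_ ι (Q 0 1) * seqPoly s (fun k => β k ι) - C c * X ^ (2 ^ k) := by
    intro ι hι
    have h2 := exists_const_of_isTransition (d := s) hk ?_ ?_ ?_ ?_ (hQ ι hι)
    · simpa [at_X_pow_sub_one, at_seqPoly] using h2
    · change (at_ ι (X ^ s - 1)).coeff 0 ≠ 0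
      rw [coeff_at, hco, if_neg hs.ne, if_pos rfl]
      simp
    · intro i hi
      change (at_ ι (X ^ s - 1)).coeff i ≠ 0 at hi
      rw [coeff_at, hco] at hi
      by_contra hc
      rw [if_neg (by omega), if_neg (by omega)] at hi
      exact hi rfl
    · intro i hi
      change (at_ ι (seqPoly s β)).coeff i ≠ 0 at hi
      rw [coeff_at, coeff_seqPoly] at hi
      by_contra hc
      rw [if_neg (by omega)] at hi
      exact hi rfl
    · intro e he he'
      refine hu ι e ?_ ?_
      · rw [← at_X_pow_sub_one]
        exact he
      · rw [← at_seqPoly]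
        exact he'
  have hdegQ : ∀ u : ℕ → ∀ ι, F ι, (Q 0 1 * seqPoly s u).degree < (s * 16 : ℕ) := fun u =>
    (degree_mul_lt_add (m := 2 ^ k + 1) ((hQdeg 0 1).trans_lt (by exact_mod_cast Nat.lt_succ_self _))
      (degree_seqPoly s u)).trans_le (by exact_mod_cast (by omega : 2 ^ k + 1 + s ≤ s * 16))
  have hdegat : ∀ (u : ℕ → ∀ ι, F ι) (ι : I), (at_ ι (Q 0 1) * seqPoly s (fun k => u k ι)).degree <
      (s * 16 : ℕ) := fun u ι => by
    rw [← at_seqPoly, ← at_mul]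
    exact degree_map_le.trans_lt (hdegQ u)
  set B := A ∪ matCf Q with hB
  have h0B : 0 ∈ B := .inl h0
  have hmul : ∀ u : ℕ → ∀ ι, F ι, (∀ i < s, u i ∈ A) →
      SLP Ω 1 1 B (M (k + 1)) (cf (Q 0 1 * seqPoly s u)) := fun u hu =>
    hM (k + 1) B h0B _ _ ((hQdeg 0 1).trans_lt (by exact_mod_cast hkk))
      ((degree_seqPoly s u).trans (by exact_mod_cast hsk.trans hkk))
      ((cf_subset_matCf Q 0 1).trans Set.subset_union_right)
      ((cf_seqPoly h0 hu).trans Set.subset_union_left)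
  set P₁ := Q 0 1 * seqPoly s β with hP₁
  set P₂ := Q 0 1 * seqPoly s (corr s β a) with hP₂
  -- `z` is the constant `c` and `y i` is `c * a i`; one division per output remains.
  set z := fold s (2 ^ k % s) P₁ with hz
  set y : ℕ → ∀ ι, F ι := fun i => fold s ((2 ^ k + (s - i)) % s) P₂ with hy
  have hs₁ := (hmul β hβA).union (hmul (corr s β a) haA)
  have hs₂ : SLP Ω 1 1 (B ∪ (cf P₁ ∪ cf P₂)) (16 + s * 16) ({z} ∪ ⋃ i < s, {y i}) :=
    (SLP.fold (.inl h0B) s _ (Set.subset_union_left.trans Set.subset_union_right)).union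
      (SLP.biUnion (fun i => {y i}) s fun i _ => SLP.fold (.inl h0B) s _
        (Set.subset_union_right.trans Set.subset_union_right))
  have hval : ∀ ι ∈ S, z ι ≠ 0 ∧ ∀ i < s, y i ι = z ι * a i ι := by
    intro ι hι
    obtain ⟨c, hc, hd⟩ := hconst ι hι
    have h2 := fold_inverse hs (fun k => by rw [hβ]) (fun k => a k ι) hd (hdegat β ι) (by
      have := hdegat (corr s β a) ι
      simp only [corr_apply] at this
      exact this)
    have hzc : z ι = c := by
      rw [hz, fold_apply, hP₁, at_mul, at_seqPoly]
      exact h2.1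
    refine ⟨by rwa [hzc], fun i hi => ?_⟩
    rw [hzc, ← h2.2 i hi, hy]
    simp only
    rw [fold_apply, hP₂, at_mul, at_seqPoly]
    simp only [corr_apply]
  have hs₃ := hs₁.trans hs₂
  have hcost : s + (2 * M (k + 1) + 16 + s * 16) =
      (M (k + 1) + M (k + 1) + (16 + s * 16)) + (0 + s) := by ring
  rw [hcost]
  refine Achieves.slp hs₃ (hΩ.trans Set.subset_union_left) ?_
  refine Achieves.divs (z := z) (.inr (.inl rfl)) (fun ι hι => (hval ι hι).1) y s
    (fun i hi => .inr (.inr (Set.mem_biUnion (x := i) hi rfl))) ?_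
  refine Achieves.output fun j => ⟨y j / z, .inr ⟨j, j.2, rfl⟩, fun ι hι => ?_⟩
  rw [Pi.div_apply, (hval ι hι).2 j j.2, mul_div_cancel_left₀ _ (hval ι hι).1]

/-- To solve a problem one may restrict to a set of instances on which multiplication is fast. -/
theorem Achieves.of_fastMul {m : ℕ} {G : ∀ ι, Fin m → F ι} {c : ℕ}
    (H : ∀ (J : Set I) (B Ω : Set (∀ ι : J, F ι)), FastMul Ω mulCost → Ω ⊆ B → 0 ∈ B → 1 ∈ B →
      -1 ∈ B → (fun z (ι : J) => z ι) '' A ⊆ B →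
      Achieves (F := fun ι : J => F ι) Set.univ B (fun ι => G ι) c) :
    Achieves Set.univ A G (c + 6) := by
  -- The six extra steps are `0`, `1`, `-1`, `2`, the test whether `2 = 0`, and the division `1 / 2`
  -- in the nonzero case.
  refine Achieves.const (c := c + 5) false (Achieves.const (c := c + 4) true ?_)
  simp only [if_true, Bool.false_eq_true, if_false]
  refine Achieves.arith (c := c + 3) (a := 0) (b := 1) (y := -1) .sub (by simp) (by simp)
    (fun ι _ => by simp [ArithOp.apply]) ?_
  refine Achieves.arith (c := c + 2) (a := 1) (b := 1) (y := 2) .add (by simp) (by simp)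
    (fun ι _ => by simp [ArithOp.apply, one_add_one_eq_two]) ?_
  set A' : Set (∀ ι, F ι) := insert 2 (insert (-1) (insert 1 (insert 0 A))) with hA'
  have hAA' : A ⊆ A' := fun x hx => .inr (.inr (.inr (.inr hx)))
  have m0 : (0 : ∀ ι, F ι) ∈ A' := .inr (.inr (.inr (.inl rfl)))
  have m1 : (1 : ∀ ι, F ι) ∈ A' := .inr (.inr (.inl rfl))
  have mn : (-1 : ∀ ι, F ι) ∈ A' := .inr (.inl rfl)
  refine Achieves.test (a := 2) (c := c + 1) (.inl rfl) ?_ ?_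
  -- In characteristic two `3 = 1`, so radix three has the inverse `h = 1`. Passing to the subtype
  -- makes this an identity in the product ring.
  · refine (Achieves.of_subtype (H _ _ {1} (fastMul (p := 3) (h := 1) (.inr rfl) ?_ rfl) ?_
      ⟨0, m0, rfl⟩ ⟨1, m1, rfl⟩ ⟨-1, mn, rfl⟩ (Set.image_mono hAA'))).mono le_rfl le_rfl (by omega)
    · funext ι
      have h2 : (2 : F ι) = 0 := ι.2.2
      change (1 : F ι) * ((3 : ℕ) : F ι) = 1
      push_cast
      linear_combination h2
    · rintro _ rfl
      exact ⟨1, m1, rfl⟩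
  · refine Achieves.div (a := 1) (b := 2) m1 (.inl rfl) (fun ι hι => hι.2) ?_
    refine Achieves.of_subtype (H _ _ {fun ι => 1 / 2}
      (fastMul (p := 2) (.inl rfl) ?_ rfl) ?_
      ⟨0, .inr m0, rfl⟩ ⟨1, .inr m1, rfl⟩ ⟨-1, .inr mn, rfl⟩
      (Set.image_mono (hAA'.trans (Set.subset_insert _ _))))
    · funext ι
      have h2 : (2 : F ι) ≠ 0 := ι.2.2
      change (1 : F ι) / 2 * ((2 : ℕ) : F ι) = 1
      push_cast
      exact div_mul_cancel₀ _ h2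
    · rintro _ rfl
      exact ⟨1 / 2, .inl rfl, rfl⟩

end transform

/-! ### Instances of the `q`-transform and the resulting trees. -/

/-- An instance of the computation of the `q`-transform. -/
structure QTInstance (s : ℕ) where
  K : Type u
  F : Type v
  [fieldK : Field K]
  [finiteK : Finite K]
  [fieldF : Field F]
  [finiteF : Finite F]
  [algebra : Algebra K F]
  E : IntermediateField K F
  β : E
  normal : IsNormalElement K E s β
  a : Fin s → F

attribute [instance] QTInstance.fieldK QTInstance.finiteK QTInstance.fieldF QTInstance.finiteF
  QTInstance.algebra

namespace QTInstance

variable {s : ℕ}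

/-- The sequence of conjugates of the normal element. -/
noncomputable def conj (k : ℕ) (ι : QTInstance.{u, v} s) : ι.F := (ι.β : ι.F) ^ Nat.card ι.K ^ k

/-- The coefficients of the linearized polynomial, continued by zero. -/
noncomputable def coeffs (i : ℕ) (ι : QTInstance.{u, v} s) : ι.F :=
  if h : i < s then ι.a ⟨i, h⟩ else 0

theorem conj_add (k : ℕ) : (conj (k + s) : ∀ ι : QTInstance.{u, v} s, ι.F) = conj k := by
  funext ι
  exact ι.normal.pow_period k

theorem qTransform_eq_corr {K : Type u} {F : Type v} [Field K] [Field F] [Algebra K F]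
    {E : IntermediateField K F} (β : E) (a : ℕ → F) (j : Fin s) :
    qTransform (Nat.card K) (β : F) (fun i : Fin s => a i) j =
      corr s (fun k => (β : F) ^ Nat.card K ^ k) a j := by
  rw [qTransform, linPoly_eval, corr, Finset.sum_range]
  refine Finset.sum_congr rfl fun i _ => ?_
  rw [conjugates, ← pow_mul, ← pow_add, add_comm (j : ℕ)]

theorem coeffs_coe (ι : QTInstance.{u, v} s) : (fun i : Fin s => coeffs (i : ℕ) ι) = ι.a := by
  funext i
  simp [coeffs]

theorem corr_eq (ι : QTInstance.{u, v} s) (j : Fin s) :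
    corr s (fun k => conj k ι) (fun k => coeffs k ι) j =
      qTransform (Nat.card ι.K) (ι.β : ι.F) ι.a j := by
  rw [← coeffs_coe]
  exact (qTransform_eq_corr ι.β _ j).symm

theorem isUnit_of_dvd (hs : 0 < s) (ι : QTInstance.{u, v} s) (e : (ι.F)[X]) (h1 : e ∣ X ^ s - 1)
    (h2 : e ∣ seqPoly s fun k => conj k ι) : IsUnit e := by
  refine isUnit_of_dvd_of_dvd hs (fun k => ι.normal.pow_period k) (fun a ha i hi => ?_) h1 h2
  refine congrFun (ι.normal.injective (fun i : Fin s => a i) ?_) ⟨i, hi⟩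
  funext j
  rw [qTransform_eq_corr]
  exact ha j j.2

end QTInstance

/-- The cost of the algorithms for the parameter `s`. -/
def qtCost (s : ℕ) : ℕ :=
  s + (2 * mulCost (Nat.clog 2 (2 * s) + 1) + 16 + s * 16) +
    jumpCost mulCost (Nat.clog 2 (2 * s)) + 6

theorem two_pow_clog_le {s : ℕ} (hs : 0 < s) : 2 ^ Nat.clog 2 (2 * s) ≤ 4 * s := by
  have h2 := Nat.pow_pred_clog_lt_self (b := 2) (by norm_num) (by omega : 1 < 2 * s)
  have h3 : 0 < Nat.clog 2 (2 * s) := Nat.clog_pos (by norm_num) (by omega)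
  obtain ⟨k', hk'⟩ := Nat.exists_eq_succ_of_ne_zero h3.ne'
  rw [hk', Nat.pred_succ] at h2
  rw [hk', pow_succ]
  omega

open QTInstance in
theorem exists_tree {s : ℕ} (hs : 0 < s) (inverse : Bool) :
    ∃ T : CompTree s (s + s), T.cost ≤ qtCost s ∧ ∀ ι : QTInstance.{u, v} s,
      T.run (Fin.append (conjugates (Nat.card ι.K) s (ι.β : ι.F))
        (if inverse then qTransform (Nat.card ι.K) (ι.β : ι.F) ι.a else ι.a)) =
      some (if inverse then ι.a else qTransform (Nat.card ι.K) (ι.β : ι.F) ι.a) := by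
  set x : Fin (s + s) → ∀ ι : QTInstance.{u, v} s, ι.F := fun j ι =>
    Fin.append (conjugates (Nat.card ι.K) s (ι.β : ι.F))
      (if inverse then qTransform (Nat.card ι.K) (ι.β : ι.F) ι.a else ι.a) j with hx
  have hxβ : ∀ k < s, conj k ∈ Set.range x := fun k hk =>
    ⟨Fin.castAdd s ⟨k, hk⟩, by funext ι; rw [hx]; simp only [Fin.append_left]; rfl⟩
  set k := Nat.clog 2 (2 * s) with hk
  have hk1 : 2 * s ≤ 2 ^ k := Nat.le_pow_clog (by norm_num) _
  have hk2 : 2 ^ k ≤ 4 * s := two_pow_clog_le hs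
  suffices h : Achieves Set.univ (Set.range x) (fun ι : QTInstance.{u, v} s =>
      if inverse then ι.a else qTransform (Nat.card ι.K) (ι.β : ι.F) ι.a) (qtCost s) by
    obtain ⟨T, hT, hr⟩ := h _ x le_rfl
    exact ⟨T, hT, fun ι => hr ι trivial⟩
  refine Achieves.of_fastMul fun J B Ω hM hΩ h0 h1 hn hB => ?_
  have hβJ : ∀ k, (fun ι : J => conj (k + s) (ι : QTInstance.{u, v} s)) = fun ι : J => conj k ι.1 :=
    fun k => by rw [conj_add]
  have hβB : ∀ i < s, (fun ι : J => conj i (ι : QTInstance.{u, v} s)) ∈ B := fun i hi =>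
    hB ⟨_, hxβ i hi, rfl⟩
  have haB : ∀ i (hi : i < s), (fun ι : J => x (Fin.natAdd s ⟨i, hi⟩) ι) ∈ B := fun i hi =>
    hB ⟨_, ⟨_, rfl⟩, rfl⟩
  cases inverse with
  | false =>
    have h := achieves_corr (β := fun k (ι : J) => conj k ι.1)
      (a := fun k (ι : J) => coeffs k ι.1) hM hs (k := k + 1) (by rw [pow_succ]; omega) hβJ h0 hΩ
      hβB fun i hi => by
        convert haB i hi using 2 with ι
        simp only [hx, Fin.append_right, QTInstance.coeffs, dif_pos hi]
        rfl
    have hG : (fun (ι : J) (j : Fin s) => corr s (fun k (ι : J) => conj k ι.1)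
        (fun k (ι : J) => coeffs k ι.1) j ι) =
        fun ι : J => qTransform (Nat.card ι.1.K) (ι.1.β : ι.1.F) ι.1.a := by
      funext ι j
      rw [corr_apply]
      exact corr_eq ι.1 j
    rw [hG] at h
    exact h.mono le_rfl le_rfl (by rw [← hk]; omega)
  | true =>
    have h := achieves_corr_inverse (β := fun k (ι : J) => conj k ι.1)
      (a := fun k (ι : J) => coeffs k ι.1) hM hs hk1 hk2 hβJ (fun ι e => isUnit_of_dvd hs ι.1 e)
      h0 h1 hn hΩ hβB fun i hi => by
        convert haB i hi using 2 with ι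
        rw [corr_apply]
        simp only [hx, Fin.append_right]
        exact corr_eq ι.1 ⟨i, hi⟩
    have hG : (fun (ι : J) (j : Fin s) => coeffs (j : ℕ) ι.1) = fun ι : J => ι.1.a := by
      funext ι
      exact coeffs_coe ι.1
    rw [hG] at h
    exact h

theorem qtComplexity_le {s : ℕ} (hs : 0 < s) : qtComplexity.{u, v} s ≤ (qtCost s : ℕ∞) := by
  refine max_le ?_ ?_
  · obtain ⟨T, hT, h⟩ := exists_tree.{u, v} hs false
    refine (iInf₂_le T ?_).trans (by exact_mod_cast hT)
    intro K F _ _ _ _ _ E β hβ a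
    exact h ⟨K, F, E, β, hβ, a⟩
  · obtain ⟨T, hT, h⟩ := exists_tree.{u, v} hs true
    refine (iInf₂_le T ?_).trans (by exact_mod_cast hT)
    intro K F _ _ _ _ _ E β hβ a
    exact h ⟨K, F, E, β, hβ, a⟩

theorem qtComplexity_zero : qtComplexity.{u, v} 0 ≤ 0 := by
  refine max_le ?_ ?_
  · refine (iInf₂_le (.output Fin.elim0) ?_).trans le_rfl
    intro K F _ _ _ _ _ E β hβ a
    rw [CompTree.run]
    congr 1
    exact Subsingleton.elim _ _
  · refine (iInf₂_le (.output Fin.elim0) ?_).trans le_rfl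
    intro K F _ _ _ _ _ E β hβ a
    rw [CompTree.run]
    congr 1
    exact Subsingleton.elim _ _

/-! ### Asymptotic estimates. -/

section bounds

theorem one_le_growth (j : ℕ) : 1 ≤ growth j := by unfold growth; omega

/-- Each of the `k` levels costs `O(2^k growth k)`. The factor is `3900 = 12 * 81 + (12 * 243 +
12)`, where the bracket is absorbed using `growth ≥ 1`. -/
theorem jumpCost_le (k : ℕ) : jumpCost mulCost k ≤ 2 ^ k * (2 + 3900 * k * growth k) := by
  induction k with
  | zero => simp [jumpCost]
  | succ k ih =>
    rw [jumpCost, mulCost]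
    have h1 := growth_mono (Nat.le_succ k)
    have h2 := one_le_growth (k + 1)
    have h3 : 3900 * k * growth k ≤ 3900 * k * growth (k + 1) := by gcongr
    have h4 : 2 ^ (k + 2) = 2 ^ (k + 1) * 2 := pow_succ _ _
    have h5 : 2 ^ (k + 1) = 2 ^ k * 2 := pow_succ _ _
    calc 2 * jumpCost mulCost k + 12 * (2 ^ (k + 1) * (81 * growth (k + 1) + 243)) +
          6 * 2 ^ (k + 2)
        ≤ 2 * (2 ^ k * (2 + 3900 * k * growth (k + 1))) +
          12 * (2 ^ (k + 1) * (81 * growth (k + 1) + 243)) + 6 * 2 ^ (k + 2) := by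
          gcongr
          exact ih.trans (Nat.mul_le_mul_left _ (by omega))
      _ = 2 ^ (k + 1) * (2 + 3900 * k * growth (k + 1) + 972 * growth (k + 1) + 2928) := by
          rw [h4, h5]; ring
      _ ≤ 2 ^ (k + 1) * (2 + 3900 * (k + 1) * growth (k + 1)) := by
          refine Nat.mul_le_mul_left _ ?_
          have h6 : 3900 * (k + 1) * growth (k + 1) =
            3900 * k * growth (k + 1) + 3900 * growth (k + 1) := by ring
          omega

theorem qtCost_le {s : ℕ} (hs : 0 < s) :
    qtCost s ≤ 4000 * (4 * s) * ((Nat.clog 2 (2 * s) + 1) * growth (Nat.clog 2 (2 * s) + 1)) := by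
  have hk1 : 2 * s ≤ 2 ^ Nat.clog 2 (2 * s) := Nat.le_pow_clog (by norm_num) _
  have hk2 := two_pow_clog_le hs
  rw [qtCost]
  set k := Nat.clog 2 (2 * s)
  have h1 := growth_mono (Nat.le_succ k)
  have h2 := one_le_growth (k + 1)
  have h3 : 3900 * k * growth k ≤ 3900 * k * growth (k + 1) := by gcongr
  have h4 := (jumpCost_le k).trans
    (Nat.mul_le_mul_left (2 ^ k) (Nat.add_le_add_left h3 2))
  have h5 : 2 * mulCost (k + 1) = 2 ^ k * (324 * growth (k + 1) + 972) := by
    rw [mulCost, pow_succ]; ring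
  have h6 : s + 16 + s * 16 + 6 ≤ 2 ^ k * 39 := by omega
  calc s + (2 * mulCost (k + 1) + 16 + s * 16) + jumpCost mulCost k + 6
      ≤ 2 ^ k * (324 * growth (k + 1) + 972) + 2 ^ k * (2 + 3900 * k * growth (k + 1)) +
        2 ^ k * 39 := by omega
    _ = 2 ^ k * (3900 * k * growth (k + 1) + 324 * growth (k + 1) + 1013) := by ring
    _ ≤ 2 ^ k * (4000 * ((k + 1) * growth (k + 1))) := by
        refine Nat.mul_le_mul_left _ ?_
        have h7 : 4000 * ((k + 1) * growth (k + 1)) = 3900 * k * growth (k + 1) +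
          100 * k * growth (k + 1) + 4000 * growth (k + 1) := by ring
        omega
    _ ≤ (4 * s) * (4000 * ((k + 1) * growth (k + 1))) := Nat.mul_le_mul_right _ hk2
    _ = _ := by ring

theorem growth_le {j : ℕ} (hj : 0 < j) : growth j ≤ 80000 * (j * (1 + Nat.log 2 j)) := by
  unfold growth
  have : 1 ≤ j * (1 + Nat.log 2 j) := Nat.mul_pos hj (by omega)
  omega

theorem qtCost_isBigO : (fun s : ℕ => (qtCost s : ℝ)) =O[atTop]
    (fun s : ℕ => (s : ℝ) * Real.log s ^ 2 * Real.log (Real.log s)) := by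
  have hlog : Tendsto (fun s : ℕ => Real.log s) atTop atTop :=
    Real.tendsto_log_atTop.comp tendsto_natCast_atTop_atTop
  refine IsBigO.of_bound (16000 * 80000 * 25 * 7) ?_
  filter_upwards [hlog.eventually_ge_atTop 1,
    (Real.tendsto_log_atTop.comp hlog).eventually_ge_atTop 1, eventually_gt_atTop 0]
    with s h1 h2 hs
  simp only [Function.comp_apply] at h2
  set L := Real.log s with hL
  set LL := Real.log L with hLL
  set k := Nat.clog 2 (2 * s) with hk
  have hsR : (0 : ℝ) < s := by exact_mod_cast hs
  have hlog2 : (1 / 2 : ℝ) ≤ Real.log 2 := by linarith [Real.log_two_gt_d9]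
  -- From `2^k ≤ 4s` and `log 2 ≥ 1/2` follows `k ≤ 2 + 2L`, and `L ≥ 1` absorbs the constants.
  have hk1 : ((k + 1 : ℕ) : ℝ) ≤ 5 * L := by
    have h3 : ((2 : ℝ) ^ k) ≤ 4 * s := by exact_mod_cast two_pow_clog_le hs
    have h4 := Real.log_le_log (by positivity) h3
    rw [Real.log_pow, Real.log_mul (by norm_num) hsR.ne', ← hL,
      show (4 : ℝ) = 2 ^ 2 by norm_num, Real.log_pow] at h4
    push_cast at h4 ⊢
    have h5 : ((k : ℝ) - 2) * Real.log 2 ≤ L := by linarith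
    rcases le_total (k : ℝ) 2 with h6 | h6
    · linarith
    · have h7 : ((k : ℝ) - 2) * (1 / 2) ≤ ((k : ℝ) - 2) * Real.log 2 :=
        mul_le_mul_of_nonneg_left hlog2 (by linarith)
      linarith
  -- Here `log (k + 1) ≤ log 5 + LL ≤ 2 + LL`, and conversion to base two at most doubles it; `LL ≥
  -- 1` absorbs the resulting `5`.
  have hk2 : ((1 + Nat.log 2 (k + 1) : ℕ) : ℝ) ≤ 7 * LL := by
    have h3 := Real.natLog_le_logb (k + 1) 2
    have hkpos : (0 : ℝ) < ((k + 1 : ℕ) : ℝ) := by positivity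
    have h4 := Real.log_le_log hkpos hk1
    rw [Real.log_mul (by norm_num) (by linarith), ← hLL] at h4
    have h5 : Real.log 5 ≤ 2 := by
      rw [Real.log_le_iff_le_exp (by norm_num)]
      have := Real.exp_one_gt_d9
      have h6 : Real.exp 2 = Real.exp 1 * Real.exp 1 := by rw [← Real.exp_add]; norm_num
      rw [h6]
      nlinarith
    have h6 : Real.logb (2 : ℕ) ((k + 1 : ℕ) : ℝ) ≤ 2 * (2 + LL) := by
      rw [Real.logb, div_le_iff₀ (by norm_num; exact Real.log_pos (by norm_num))]
      push_cast at h4 ⊢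
      nlinarith
    push_cast at h3 h6 ⊢
    linarith
  have hbound : (qtCost s : ℝ) ≤ 16000 * 80000 * s *
      (((k + 1 : ℕ) : ℝ) * ((k + 1 : ℕ) : ℝ) * ((1 + Nat.log 2 (k + 1) : ℕ) : ℝ)) := by
    have h3 := (qtCost_le hs).trans (Nat.mul_le_mul_left _ (Nat.mul_le_mul_left _
      (growth_le (Nat.succ_pos _))))
    calc (qtCost s : ℝ) ≤ ((4000 * (4 * s) * ((k + 1) *
          (80000 * ((k + 1) * (1 + Nat.log 2 (k + 1))))) : ℕ) : ℝ) := by exact_mod_cast h3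
      _ = _ := by push_cast; ring
  rw [Real.norm_of_nonneg (by positivity), Real.norm_of_nonneg (by positivity)]
  calc (qtCost s : ℝ) ≤ _ := hbound
    _ ≤ 16000 * 80000 * s * ((5 * L) * (5 * L) * (7 * LL)) := by gcongr
    _ = _ := by ring

end bounds

theorem mainTheorem6 :
    (∀ s : ℕ, qtComplexity.{u, v} s ≠ ⊤) ∧
      (fun s : ℕ => ((qtComplexity.{u, v} s).toNat : ℝ)) =O[atTop]
        (fun s : ℕ => (s : ℝ) * Real.log s ^ 2 * Real.log (Real.log s)) := by
  refine ⟨fun s => ?_, IsBigO.trans (IsBigO.of_bound 1 ?_) qtCost_isBigO⟩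
  · rcases Nat.eq_zero_or_pos s with rfl | hs
    · exact ne_top_of_le_ne_top ENat.zero_ne_top qtComplexity_zero
    · exact ne_top_of_le_ne_top (ENat.natCast_ne_top _) (qtComplexity_le hs)
  · filter_upwards [eventually_gt_atTop 0] with s hs
    rw [one_mul, Real.norm_natCast, Real.norm_natCast]
    exact_mod_cast ENat.toNat_le_of_le_natCast (qtComplexity_le hs)
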